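/- **Setting.** Consider $\mathbb R^n$ with scalar product $(x,y)=x^Ty$, let $x\wedge y=xy^T-yx^T$, and identify $so(n)\cong so(n)^*$ by $\langle X,Y\rangle=-\tfrac12\mathrm{tr}(XY)$. A balanced ball of radius $\rho>0$ and mass $m>0$ rolls over a fixed sphere of radius $\sigma>0$ centred at the origin, in one of three variants: (i) over its outer surface (sign $+$); (ii) over its inner surface, $\sigma>\rho$ (sign $-$); (iii) over its outer surface with the fixed sphere inside the rolling spherical shell, $\sigma<\rho$ (sign $-$). The configuration space is $Q=\{(g,\mathbf r): g\in SO(n),\ (\mathbf r,\mathbf r)=(\sigma\pm\rho)^2\}\cong SO(n)\times S^{n-1}$. Put $\omega=g^{-1}\dot g$, $\Omega=\dot gg^{-1}$, $\mathbf V=\dot{\mathbf r}$, $\mathbf\Gamma=\mathbf r/(\sigma\pm\rho)$, $\gamma=\pi(g,\mathbf r)=g^{-1}\mathbf\Gamma\in S^{n-1}$, $$\epsilon=\frac{\sigma}{\sigma\pm\rho},\qquad D=m\rho^2 .$$ The Lagrangian is $L=\tfrac12\langle\mathbb I\omega,\omega\rangle+\tfrac12m(\mathbf V,\mathbf V)$,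 where $\mathbb I:so(n)\to so(n)$ is symmetric and positive definite, and $\mathbf I=\mathbb I+D\,\mathrm{Id}$. The constraint distribution $\mathcal F\subset TQ$ is given by no slipping, $\mathbf V=\pm\rho\,\Omega\mathbf\Gamma$, and no twisting, $\langle\omega,x\wedge y\rangle=0$ for all $x,y\perp\gamma$. A motion is a $C^2$ curve in $Q$ tangent to $\mathcal F$ that satisfies the Lagrange–d'Alembert equations: $\big(\tfrac{d}{dt}\tfrac{\partial L}{\partial\dot q}-\tfrac{\partial L}{\partial q}\big)(\delta q)=0$ for all $\delta q\in\mathcal F_{q}$. The group $SO(n)$ acts by $a\cdot(g,\mathbf r)=(ag,a\mathbf r)$; $\pi:Q\to S^{n-1}$ is the quotient map. For $\xi\in T_\gamma S^{n-1}$ and $q\in\pi^{-1}(\gamma)$ let $\xi^h\in\mathcal F_q$ be the horizontal lift, i.e. the vector of $\mathcal F_q$ with $d\pi(\xi^h)=\xi$; let $J$ be the momentum mapping of the action, $\langle J_q(v),\eta\rangle=\tfrac{\partial L}{\partial \dot q}(q,v)(\eta\cdot q)$, and let the curvature $K_q(v_1,v_2)=\eta\in so(n)$ be defined by: $\eta\cdot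 q$ is the vertical component of $[X_2,X_1]$ at $q$ (along $TQ=\mathcal F\oplus\ker d\pi$), where $X_1,X_2$ are smooth vector fields with values in $\mathcal F$ that extend $v_1,v_2\in\mathcal F_q$. **Theorem 4.3.** Horizontal lifts exist and are unique, and the reduced Lagrangian is $$L_{red}(\gamma,\dot\gamma)=L(\dot\gamma^h)=\frac1{2\epsilon^2}\langle\mathbf I(\gamma\wedge\dot\gamma),\gamma\wedge\dot\gamma\rangle .$$ Let $\mathcal T\subset\mathbb R$ be an open interval. (1) For every $C^2$ curve $\gamma:\mathcal T\to S^{n-1}$, every $t\in\mathcal T$ and $\xi\in T_{\gamma(t)}S^{n-1}$, the reduced Lagrange–d'Alembert equation $$\Big(\frac{\partial L_{red}}{\partial\gamma}-\frac{d}{dt}\frac{\partial L_{red}}{\partial\dot\gamma},\xi\Big)=\langle J_q(\dot\gamma^h),K_q(\dot\gamma^h,\xi^h)\rangle\qquad\text{for all } q\in\pi^{-1}(\gamma(t))$$ holds if and only if $$\Big(\epsilon\frac{d}{dt}\big(\mathbf I(\gamma\wedge\dot\gamma)\gamma\big)+(1-\epsilon)\,\mathbf I(\gamma\wedge\dot\gamma)\dot\gamma,\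 \xi\Big)=0. \tag{$*$}$$ (2) A $C^2$ curve $q:\mathcal T\to Q$ tangent to $\mathcal F$ is a motion if and only if $\gamma=\pi\circ q$ satisfies $(*)$ for all $t\in\mathcal T$ and all $\xi\in T_{\gamma(t)}S^{n-1}$. (3) If a $C^2$ curve $\gamma:\mathcal T\to S^{n-1}$ satisfies $(*)$ for all $t\in\mathcal T$ and all $\xi\in T_{\gamma(t)}S^{n-1}$, then for every $t_0\in\mathcal T$ and $q_0\in\pi^{-1}(\gamma(t_0))$ there is a unique motion $q:\mathcal T\to Q$ with $q(t_0)=q_0$ and $\pi\circ q=\gamma$. -/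

import Mathlib

open scoped Matrix ContDiff

/- Spaces of matrices get the entrywise sup norm; it is only used to speak of derivatives. -/
attribute [local instance] Matrix.normedAddCommGroup Matrix.normedSpace

namespace RubberRolling

noncomputable section

/-- Column vectors in `ℝⁿ`; the Euclidean scalar product is `x ⬝ᵥ y = xᵀ y`. -/
abbrev Vec (n : ℕ) : Type := Fin n → ℝ

/-- Real `n × n` matrices. -/
abbrev Mat (n : ℕ) : Type := Matrix (Fin n) (Fin n) ℝ

/-- The Lie algebra `so(n)` of skew-symmetric matrices. -/
abbrev So (n : ℕ) : Type := LieAlgebra.Orthogonal.so (Fin n) ℝ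

/-- The ambient vector space `Mat n × ℝⁿ` of the configuration space. Points are pairs `(g, r)`,
tangent vectors are pairs `(ġ, V)`. -/
abbrev Amb (n : ℕ) : Type := Mat n × Vec n

/-- The invariant scalar product `⟨X, Y⟩ = -½ tr (X Y)`. -/
def ip {n : ℕ} (X Y : So n) : ℝ := -(1 / 2) * ((X : Mat n) * (Y : Mat n)).trace

/-- The skew-symmetric part of a matrix; it is the identity on skew-symmetric matrices. -/
def skewPart {n : ℕ} (A : Mat n) : So n :=
  ⟨(1 / 2 : ℝ) • (A - Aᵀ), by
    rw [LieAlgebra.Orthogonal.mem_so]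
    simp [Matrix.transpose_sub, ← smul_neg]⟩

theorem skewPart_coe {n : ℕ} (X : So n) : skewPart (X : Mat n) = X := by
  have h := (LieAlgebra.Orthogonal.mem_so (Fin n) ℝ (X : Mat n)).1 X.2
  apply Subtype.ext
  change (1 / 2 : ℝ) • ((X : Mat n) - (X : Mat n)ᵀ) = X
  rw [h, sub_neg_eq_add, ← two_smul ℝ, smul_smul]
  norm_num

/-- The wedge product `x ∧ y = x yᵀ - y xᵀ`. -/
def wedge {n : ℕ} (x y : Vec n) : So n :=
  ⟨Matrix.vecMulVec x y - Matrix.vecMulVec y x, by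
    rw [LieAlgebra.Orthogonal.mem_so]
    simp [Matrix.transpose_sub, Matrix.transpose_vecMulVec]⟩

/-- The Euler–Lagrange covector `d/dt (∂L/∂q̇) - ∂L/∂q` along a curve `q`, at time `t`. -/
def eulerLagrange {V : Type*} [NormedAddCommGroup V] [NormedSpace ℝ V]
    (L : V → V → ℝ) (q : ℝ → V) (t : ℝ) : V →L[ℝ] ℝ :=
  deriv (fun s => fderiv ℝ (fun v => L (q s) v) (deriv q s)) t
    - fderiv ℝ (fun x => L x (deriv q t)) (q t)

/-- The three variants of the rolling problem: over the outer surface of the fixed sphere; over its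
inner surface; over the outer surface, with the fixed sphere inside the rolling spherical shell. -/
inductive RollingCase
  | outer
  | inner
  | shell

/-- The sign `±` of the three variants. -/
def RollingCase.sign : RollingCase → ℝ
  | outer => 1
  | inner => -1
  | shell => -1

/-- The restriction on the radii `σ` (fixed sphere) and `ρ` (rolling ball) in each variant. -/
def RollingCase.Admissible : RollingCase → ℝ → ℝ → Prop
  | outer, _, _ => True
  | inner, σ, ρ => ρ < σ
  | shell, σ, ρ => σ < ρ

/-- The data of the rolling problem in `ℝⁿ`: the variant, the radius `σ` of the fixed sphere,
the radius `ρ` and the mass of the ball, and its inertia operator, which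
defines a left-invariant Riemannian metric on `SO(n)`. -/
structure Ball (n : ℕ) where
  variant : RollingCase
  σ : ℝ
  ρ : ℝ
  mass : ℝ
  inertia : So n →ₗ[ℝ] So n
  σ_pos : 0 < σ
  ρ_pos : 0 < ρ
  mass_pos : 0 < mass
  admissible : variant.Admissible σ ρ
  inertia_symm : ∀ X Y : So n, ip (inertia X) Y = ip X (inertia Y)
  inertia_pos : ∀ X : So n, X ≠ 0 → 0 < ip (inertia X) X

namespace Ball

variable {n : ℕ} (B : Ball n)

/-- The sign `±`. -/
def sgn : ℝ := B.variant.sign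

/-- `σ ± ρ`; the centre of the ball is at distance `|σ ± ρ|` from the origin. -/
def radius : ℝ := B.σ + B.sgn * B.ρ

/-- The parameter `ε = σ / (σ ± ρ)`. -/
def eps : ℝ := B.σ / B.radius

/-- `D = m ρ²`. -/
def D : ℝ := B.mass * B.ρ ^ 2

/-- The modified inertia operator `𝐈 = 𝕀 + D · id`. -/
def modInertia : So n →ₗ[ℝ] So n := B.inertia + B.D • LinearMap.id

/-- The configuration space `SO(n) × S^{n-1}`: rotation matrices `g` and positions `r` of the
centre with `(r, r) = (σ ± ρ)²`. -/
def config : Set (Amb n) :=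
  {q | q.1 ∈ Matrix.specialOrthogonalGroup (Fin n) ℝ ∧ q.2 ⬝ᵥ q.2 = B.radius ^ 2}

/-- The unit normal `Γ = r / (σ ± ρ)` at the contact point, in the fixed frame. -/
def normal (q : Amb n) : Vec n := B.radius⁻¹ • q.2

/-- The projection `π(g, r) = γ = g⁻¹ Γ` to `S^{n-1}`; for rotations `g⁻¹ = gᵀ`. -/
def proj (q : Amb n) : Vec n := q.1ᵀ *ᵥ B.normal q

/-- The generator `η · (g, r) = (η g, η r)` of the action `a · (g, r) = (a g, a r)` of `SO(n)`. -/
def generator (η : So n) (q : Amb n) : Amb n := ((η : Mat n) * q.1, (η : Mat n) *ᵥ q.2)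

/-- The constraint distribution at `q = (g, r)`: velocities `(ġ, V)` with
`ġ = g ω`, `ω ∈ so(n)`, no slipping `V = ± ρ Ω Γ` where `Ω = g ω g⁻¹`, and no twisting,
`⟨ω, x ∧ y⟩ = 0` for all `x, y` orthogonal to `γ`. -/
def distribution (q : Amb n) : Set (Amb n) :=
  {v | ∃ w : So n, v.1 = q.1 * (w : Mat n) ∧
    v.2 = (B.sgn * B.ρ) • ((q.1 * (w : Mat n) * q.1ᵀ) *ᵥ B.normal q) ∧
    ∀ x y : Vec n, x ⬝ᵥ B.proj q = 0 → y ⬝ᵥ B.proj q = 0 → ip w (wedge x y) = 0}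

/-- The Lagrangian `L = ½ ⟨𝕀 ω, ω⟩ + ½ m (V, V)`, `ω = g⁻¹ ġ`. On velocities tangent to
the configuration space `gᵀ ġ = g⁻¹ ġ` is skew-symmetric; taking `gᵀ` and the skew-symmetric part
extends the Lagrangian smoothly to the ambient space. The value of the
Euler–Lagrange covector on tangent vectors of the configuration space, along curves in it,
does not depend on the extension. -/
def lagrangian (q v : Amb n) : ℝ :=
  1 / 2 * ip (B.inertia (skewPart (q.1ᵀ * v.1))) (skewPart (q.1ᵀ * v.1))
    + 1 / 2 * B.mass * (v.2 ⬝ᵥ v.2)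

/-- A curve of class `C²` in the configuration space, over the open interval `J`,
that satisfies the constraints. -/
def IsAdmissibleCurve (J : Set ℝ) (q : ℝ → Amb n) : Prop :=
  ContDiffOn ℝ 2 q J ∧ ∀ t ∈ J, q t ∈ B.config ∧ deriv q t ∈ B.distribution (q t)

/-- The Lagrange–d'Alembert equations for the constrained system on `SO(n) × S^{n-1}`: along `q`, the
Euler–Lagrange covector vanishes on all virtual displacements in the constraint distribution. -/
def LagrangeDAlembert (J : Set ℝ) (q : ℝ → Amb n) : Prop :=
  ∀ t ∈ J, ∀ δ ∈ B.distribution (q t), eulerLagrange B.lagrangian q t δ = 0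

/-- A motion of the rubber ball over the open interval `J`. -/
def IsMotion (J : Set ℝ) (q : ℝ → Amb n) : Prop :=
  B.IsAdmissibleCurve J q ∧ B.LagrangeDAlembert J q

/-- `v` is a horizontal vector at `q` over the base vector `ξ`. -/
def IsHorizontalLift (q : Amb n) (ξ : Vec n) (v : Amb n) : Prop :=
  v ∈ B.distribution q ∧ fderiv ℝ B.proj q v = ξ

/-- The horizontal lift `ξʰ` at `q`: the unique horizontal vector over `ξ`. -/
def horizontalLift (q : Amb n) (ξ : Vec n) : Amb n :=
  Classical.epsilon (B.IsHorizontalLift q ξ)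

/-- Smooth horizontal vector fields, as restrictions of smooth vector fields on the
ambient space. -/
def IsHorizontalField (X : Amb n → Amb n) : Prop :=
  ContDiff ℝ ∞ X ∧ ∀ q ∈ B.config, X q ∈ B.distribution q

/-- `η · q` is the vertical component of `[X₂, X₁]` at `q`, for smooth
horizontal extensions `X₁, X₂` of `v₁, v₂`. -/
def IsCurvature (q v₁ v₂ : Amb n) (η : So n) : Prop :=
  ∃ X₁ X₂ : Amb n → Amb n, B.IsHorizontalField X₁ ∧ B.IsHorizontalField X₂ ∧
    X₁ q = v₁ ∧ X₂ q = v₂ ∧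
    VectorField.lieBracket ℝ X₂ X₁ q - generator η q ∈ B.distribution q

/-- The `so(n)`-valued curvature `K_q(v₁, v₂)` of the connection: the unique `η` as above. -/
def curvature (q v₁ v₂ : Amb n) : So n := Classical.epsilon (B.IsCurvature q v₁ v₂)

/-- The momentum mapping of the `SO(n)`-action, as an element of `so(n)*`:
`J_q(v)(η) = (∂L/∂q̇)(q, v) (η · q)`. -/
def momentum (q v : Amb n) (η : So n) : ℝ :=
  fderiv ℝ (fun w => B.lagrangian q w) v (generator η q)

/-- The reduced Lagrangian `L_red = 1/(2ε²) ⟨𝐈 (γ ∧ γ̇), γ ∧ γ̇⟩`, in redundant variables. -/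
def reducedLagrangian (γ v : Vec n) : ℝ :=
  1 / (2 * B.eps ^ 2) * ip (B.modInertia (wedge γ v)) (wedge γ v)

/-- The reduced Lagrange–d'Alembert equation at time `t`, tested on `ξ ∈ T_γ S^{n-1}`:
`(∂L_red/∂γ - d/dt ∂L_red/∂γ̇, ξ) = ⟨J_q(γ̇ʰ), K_q(γ̇ʰ, ξʰ)⟩` at the points `q` over `γ(t)`. -/
def ReducedLagrangeDAlembert (γ : ℝ → Vec n) (t : ℝ) (ξ : Vec n) : Prop :=
  ∀ q ∈ B.config, B.proj q = γ t →
    -(eulerLagrange B.reducedLagrangian γ t ξ) =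
      B.momentum q (B.horizontalLift q (deriv γ t))
        (B.curvature q (B.horizontalLift q (deriv γ t)) (B.horizontalLift q ξ))

/-- A curve of class `C²` on the unit sphere `S^{n-1}`, over the open interval `J`. -/
def IsSphereCurve (J : Set ℝ) (γ : ℝ → Vec n) : Prop :=
  ContDiffOn ℝ 2 γ J ∧ ∀ t ∈ J, γ t ⬝ᵥ γ t = 1

/-- `(ε d/dt (𝐈(γ ∧ γ̇) γ) + (1 - ε) 𝐈(γ ∧ γ̇) γ̇, ξ) = 0` at time `t`. -/
def ReducedEquation (γ : ℝ → Vec n) (t : ℝ) (ξ : Vec n) : Prop :=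
  (B.eps • deriv (fun s => (B.modInertia (wedge (γ s) (deriv γ s)) : Mat n) *ᵥ γ s) t
    + (1 - B.eps) • ((B.modInertia (wedge (γ t) (deriv γ t)) : Mat n) *ᵥ deriv γ t)) ⬝ᵥ ξ = 0

end Ball

end

end RubberRolling

/-! At a configuration over `γ`, the no-twisting condition says exactly that `ω = γ ∧ u` with `u ⟂
γ`, and no slipping then forces `V = -(±ρ) g u` (`mem_distribution_iff`). Since `dπ` sends this
vector to `ε u`, the horizontal lift of `ξ` has `u = ε⁻¹ ξ`. The translational energy is `D/2` times
`|γ ∧ u|²`, which turns the inertia operator `𝕀` into `𝐈`.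

Two scalars govern all equations: `a = ⟨𝐈(γ ∧ γ̈), γ ∧ ξ⟩` and `b = ⟨𝐈(γ ∧ γ̇), ξ ∧ γ̇⟩`. The
equation `(*)` reads `b - ε a = 0`; the Euler–Lagrange covector of the reduced Lagrangian is `ε⁻² (a
- 2b)`; and the momentum-curvature term is `(2ε - 1) ε⁻³ b`, because the curvature of two horizontal
vectors is `(2ε - 1) g u₂ ∧ g u₁`. This gives the first equivalence. The curvature comes from the
bracket of two explicit horizontal fields; a connection form shows that other extensions give the
same vertical part.

The second equivalence does not pass through reduction theory: the full Euler–Lagrange covector on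
the horizontal vector of `u = ξ` is computed to be `-ε⁻² (b - ε a)`.

For the lifting, `γ` determines the body angular velocity `ε⁻¹ γ ∧ γ̇`, so `g` solves a linear
equation `ġ = g W` with `W` skew-symmetric. It has a solution on the whole interval, and `r = (σ ±
ρ) g γ`. Uniqueness holds because `g hᵀ` is constant for two solutions. -/

section LinearEquation

/-! ### Linear differential equations on an open interval. -/

open MeasureTheory Set

variable {E : Type*} [NormedAddCommGroup E] [NormedSpace ℝ E]

/-- The Picard iterates of the linear equation `x' = A t x`, `x t₀ = x₀`. -/
noncomputable def linearPicard (A : ℝ → E →L[ℝ] E) (t₀ : ℝ) (x₀ : E) : ℕ → ℝ → E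
  | 0 => fun _ => x₀
  | k + 1 => fun t => ∫ s in t₀..t, A s (linearPicard A t₀ x₀ k s)

variable {A : ℝ → E →L[ℝ] E} {J : Set ℝ} {t₀ : ℝ} {x₀ : E}

theorem continuousOn_and_hasDerivAt_linearPicard [CompleteSpace E] (hJ : IsOpen J) (hJ' : J.OrdConnected)
    (hA : ContinuousOn A J) (ht₀ : t₀ ∈ J) (k : ℕ) :
    ContinuousOn (linearPicard A t₀ x₀ k) J ∧ ∀ t ∈ J,
      HasDerivAt (linearPicard A t₀ x₀ (k + 1)) (A t (linearPicard A t₀ x₀ k t)) t := by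
  have key : ∀ k, ContinuousOn (linearPicard A t₀ x₀ k) J → ∀ t ∈ J,
      HasDerivAt (linearPicard A t₀ x₀ (k + 1)) (A t (linearPicard A t₀ x₀ k t)) t := by
    intro k hk t ht
    have hc : ContinuousOn (fun s => A s (linearPicard A t₀ x₀ k s)) J := hA.clm_apply hk
    exact intervalIntegral.integral_hasDerivAt_right
      ((hc.mono (hJ'.uIcc_subset ht₀ ht)).intervalIntegrable)
      (hc.stronglyMeasurableAtFilter hJ t ht) (hc.continuousAt (hJ.mem_nhds ht))
  have hcont : ∀ k, ContinuousOn (linearPicard A t₀ x₀ k) J := by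
    intro k
    induction k with
    | zero => exact continuousOn_const
    | succ k ih => exact fun t ht => (key k ih t ht).continuousAt.continuousWithinAt
  exact ⟨hcont k, key k (hcont k)⟩

/-- Each integration of `|s - t₀| ^ k` contributes a factor `1 / (k + 1)`, whence the factorial. The
iterates here are the terms of a series, and this bound makes it converge uniformly on bounded
intervals where `A` is bounded. -/
theorem norm_linearPicard_le {K : Set ℝ} (hK : K.OrdConnected)
    (ht₀ : t₀ ∈ K) {M : ℝ} (hM : ∀ t ∈ K, ‖A t‖ ≤ M) (k : ℕ) :
    ∀ t ∈ K, ‖linearPicard A t₀ x₀ k t‖ ≤ ‖x₀‖ * ((M * |t - t₀|) ^ k / k.factorial) := by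
  have hM0 : 0 ≤ M := (norm_nonneg _).trans (hM _ ht₀)
  induction k with
  | zero => intro t _; simp [linearPicard]
  | succ k ih =>
    intro t ht
    have hsub : Set.uIoc t₀ t ⊆ K := Set.uIoc_subset_uIcc.trans (hK.uIcc_subset ht₀ ht)
    calc ‖linearPicard A t₀ x₀ (k + 1) t‖
        ≤ ∫ s in Set.uIoc t₀ t, ‖A s (linearPicard A t₀ x₀ k s)‖ :=
          intervalIntegral.norm_integral_le_integral_norm_uIoc
      _ ≤ ∫ s in Set.uIoc t₀ t, ‖x₀‖ * M ^ (k + 1) / k.factorial * |s - t₀| ^ k := by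
          refine integral_mono_of_nonneg (ae_of_all _ fun _ => norm_nonneg _) ?_ ?_
          · have : Continuous fun s : ℝ => ‖x₀‖ * M ^ (k + 1) / k.factorial * |s - t₀| ^ k := by
              fun_prop
            exact (intervalIntegrable_iff.1 (this.intervalIntegrable t₀ t))
          · refine (ae_restrict_iff' measurableSet_uIoc).2 (ae_of_all _ fun s hs => ?_)
            have h1 := ih s (hsub hs)
            calc ‖A s (linearPicard A t₀ x₀ k s)‖ ≤ ‖A s‖ * ‖linearPicard A t₀ x₀ k s‖ :=
                  (A s).le_opNorm _
              _ ≤ M * (‖x₀‖ * ((M * |s - t₀|) ^ k / k.factorial)) := by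
                  gcongr
                  exact hM s (hsub hs)
              _ = _ := by rw [mul_pow]; ring
      _ = _ := by
          rw [integral_const_mul, integral_pow_abs_sub_uIoc, mul_pow, Nat.factorial_succ]
          have : (k.factorial : ℝ) ≠ 0 := by positivity
          push_cast
          field_simp

/-- A linear differential equation with continuous coefficients on an open interval has a solution
on the whole interval. -/
theorem exists_hasDerivAt_linear [CompleteSpace E] (hJ : IsOpen J) (hJ' : J.OrdConnected)
    (hA : ContinuousOn A J) (ht₀ : t₀ ∈ J) (x₀ : E) :
    ∃ x : ℝ → E, x t₀ = x₀ ∧ ∀ t ∈ J, HasDerivAt x (A t (x t)) t := by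
  -- The solution is the sum of the iterates: differentiation sends term `k + 1` to `A` applied to
  -- term `k`.
  refine ⟨fun t => ∑' k, linearPicard A t₀ x₀ k t, ?_, fun t ht => ?_⟩
  · refine (tsum_eq_single 0 fun k hk => ?_).trans rfl
    obtain ⟨j, rfl⟩ := Nat.exists_eq_succ_of_ne_zero hk
    simp [linearPicard]
  -- `A` need not be bounded on `J`, so termwise differentiation takes place on a compact
  -- subinterval with both `t₀` and `t` in its interior.
  obtain ⟨a, b, hab, hmem, hsub⟩ : ∃ a b : ℝ, t₀ ∈ Ioo a b ∧ t ∈ Ioo a b ∧ Icc a b ⊆ J := by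
    obtain ⟨e, he, hb⟩ := Metric.isOpen_iff.1 hJ _ (min_rec' (· ∈ J) ht₀ ht)
    obtain ⟨e', he', hb'⟩ := Metric.isOpen_iff.1 hJ _ (max_rec' (· ∈ J) ht₀ ht)
    refine ⟨min t₀ t - e / 2, max t₀ t + e' / 2, ⟨?_, ?_⟩, ⟨?_, ?_⟩, hJ'.out (hb ?_) (hb' ?_)⟩
    · linarith [min_le_left t₀ t]
    · linarith [le_max_left t₀ t]
    · linarith [min_le_right t₀ t]
    · linarith [le_max_right t₀ t]
    · rw [Metric.mem_ball, Real.dist_eq, abs_lt]; constructor <;> linarith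
    · rw [Metric.mem_ball, Real.dist_eq, abs_lt]; constructor <;> linarith
  obtain ⟨M, hM⟩ := isCompact_Icc.exists_bound_of_continuousOn (hA.mono hsub)
  have hmem0 : t₀ ∈ Icc a b := Ioo_subset_Icc_self hab
  have hM0 : 0 ≤ M := (norm_nonneg _).trans (hM _ hmem0)
  have hbd : ∀ k, ∀ s ∈ Icc a b,
      ‖linearPicard A t₀ x₀ k s‖ ≤ ‖x₀‖ * ((M * (b - a)) ^ k / k.factorial) := by
    intro k s hs
    refine (norm_linearPicard_le ordConnected_Icc hmem0 hM k s hs).trans ?_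
    have : |s - t₀| ≤ b - a := abs_le.2
      ⟨by linarith [hs.1, hs.2, hmem0.1, hmem0.2], by linarith [hs.1, hs.2, hmem0.1, hmem0.2]⟩
    gcongr
  have hsum : Summable fun k : ℕ => ‖x₀‖ * ((M * (b - a)) ^ k / k.factorial) :=
    (Real.summable_pow_div_factorial _).mul_left _
  have hsum' : ∀ s ∈ Icc a b, Summable fun k => linearPicard A t₀ x₀ k s := fun s hs =>
    .of_norm_bounded hsum fun k => hbd k s hs
  have hderiv : HasDerivAt (fun s => ∑' k, linearPicard A t₀ x₀ (k + 1) s)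
      (∑' k, A t (linearPicard A t₀ x₀ k t)) t := by
    refine hasDerivAt_tsum_of_isPreconnected (hsum.mul_left M) isOpen_Ioo isPreconnected_Ioo
      (fun k y hy => (continuousOn_and_hasDerivAt_linearPicard hJ hJ' hA ht₀ k).2 y
        (hsub (Ioo_subset_Icc_self hy))) (fun k y hy => ?_) hmem
      ((summable_nat_add_iff 1).2 (hsum' t (Ioo_subset_Icc_self hmem))) hmem
    refine ((A y).le_opNorm _).trans ?_
    gcongr
    · exact hM y (Ioo_subset_Icc_self hy)
    · exact hbd k y (Ioo_subset_Icc_self hy)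
  rw [← (A t).map_tsum (hsum' t (Ioo_subset_Icc_self hmem))] at hderiv
  refine (hderiv.const_add x₀).congr_of_eventuallyEq ?_
  filter_upwards [isOpen_Ioo.mem_nhds hmem] with s hs
  rw [(hsum' s (Ioo_subset_Icc_self hs)).tsum_eq_zero_add]
  rfl

end LinearEquation

/-! ### Calculus of bilinear expressions in finite dimension. -/

namespace IsBilinearMap

variable {E F G : Type*} [NormedAddCommGroup E] [NormedSpace ℝ E] [FiniteDimensional ℝ E]
  [NormedAddCommGroup F] [NormedSpace ℝ F] [FiniteDimensional ℝ F]
  [NormedAddCommGroup G] [NormedSpace ℝ G] {f : E → F → G}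

theorem hasDerivAt (h : IsBilinearMap ℝ f) {u : ℝ → E} {v : ℝ → F} {u' : E} {v' : F} {t : ℝ}
    (hu : HasDerivAt u u' t) (hv : HasDerivAt v v' t) :
    HasDerivAt (fun s => f (u s) (v s)) (f u' (v t) + f (u t) v') t := by
  rw [add_comm]
  exact h.toContinuousBilinearMap.hasDerivAt_of_bilinear (fun _ => hu) (fun _ => hv)

theorem contDiffOn (h : IsBilinearMap ℝ f) {D : Type*} [NormedAddCommGroup D] [NormedSpace ℝ D]
    {u : D → E} {v : D → F} {s : Set D} {k : ℕ∞ω}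
    (hu : ContDiffOn ℝ k u s) (hv : ContDiffOn ℝ k v s) :
    ContDiffOn ℝ k (fun x => f (u x) (v x)) s :=
  (h.toContinuousBilinearMap.contDiff.comp_contDiffOn hu).clm_apply hv

theorem contDiff (h : IsBilinearMap ℝ f) {D : Type*} [NormedAddCommGroup D] [NormedSpace ℝ D]
    {u : D → E} {v : D → F} {k : ℕ∞ω} (hu : ContDiff ℝ k u) (hv : ContDiff ℝ k v) :
    ContDiff ℝ k (fun x => f (u x) (v x)) := by
  rw [← contDiffOn_univ] at *
  exact h.contDiffOn hu hv

end IsBilinearMap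

/-- The derivative of `f` at `x` in the direction `v`, computed along a curve. -/
theorem fderiv_apply_of_hasDerivAt {E F : Type*} [NormedAddCommGroup E] [NormedSpace ℝ E]
    [NormedAddCommGroup F] [NormedSpace ℝ F] {f : E → F} {c : ℝ → E} {v : E} {d : F} {t : ℝ}
    (hf : DifferentiableAt ℝ f (c t)) (hc : HasDerivAt c v t)
    (h : HasDerivAt (fun s => f (c s)) d t) : fderiv ℝ f (c t) v = d :=
  (hf.hasFDerivAt.comp_hasDerivAt t hc).unique h

/-- The directional derivative of `f` at `x`, computed along a straight line. -/
theorem fderiv_apply_of_hasDerivAt_line {E F : Type*} [NormedAddCommGroup E] [NormedSpace ℝ E]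
    [NormedAddCommGroup F] [NormedSpace ℝ F] {f : E → F} {x v : E} {d : F}
    (hf : DifferentiableAt ℝ f x)
    (h : HasDerivAt (fun s : ℝ => f (x + s • v)) d 0) : fderiv ℝ f x v = d := by
  have hc : HasDerivAt (fun s : ℝ => x + s • v) v 0 := by
    simpa using ((hasDerivAt_id (0 : ℝ)).smul_const v).const_add x
  have := fderiv_apply_of_hasDerivAt (c := fun s : ℝ => x + s • v) (by simpa using hf) hc h
  simpa using this

section Bilinear

variable {ι : Type*} [Fintype ι]

theorem isBilinearMap_matrix_mul :
    IsBilinearMap ℝ (fun A C : Matrix ι ι ℝ => A * C) where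
  add_left := add_mul
  smul_left := fun c A C => by simp
  add_right := mul_add
  smul_right := fun c A C => by simp

theorem isBilinearMap_mulVec :
    IsBilinearMap ℝ (fun (A : Matrix ι ι ℝ) (x : ι → ℝ) => A *ᵥ x) where
  add_left := fun A C x => Matrix.add_mulVec A C x
  smul_left := fun c A x => Matrix.smul_mulVec c A x
  add_right := fun A x y => Matrix.mulVec_add A x y
  smul_right := fun c A x => Matrix.mulVec_smul A c x

theorem isBilinearMap_dotProduct :
    IsBilinearMap ℝ (fun x y : ι → ℝ => x ⬝ᵥ y) where
  add_left := fun x y z => add_dotProduct x y z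
  smul_left := fun c x y => smul_dotProduct c x y
  add_right := fun x y z => dotProduct_add x y z
  smul_right := fun c x y => dotProduct_smul c x y

/-- Transposition as a continuous linear map. -/
noncomputable def transposeCLM (ι : Type*) [Fintype ι] : Matrix ι ι ℝ →L[ℝ] Matrix ι ι ℝ :=
  LinearMap.toContinuousLinearMap (Matrix.transposeLinearEquiv ι ι ℝ ℝ).toLinearMap

theorem HasDerivAt.matrix_transpose {A : ℝ → Matrix ι ι ℝ} {A' : Matrix ι ι ℝ} {t : ℝ}
    (h : HasDerivAt A A' t) : HasDerivAt (fun s => (A s)ᵀ) A'ᵀ t :=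
  (transposeCLM ι).hasFDerivAt.comp_hasDerivAt t h

theorem ContDiff.matrix_transpose {D : Type*} [NormedAddCommGroup D] [NormedSpace ℝ D]
    {A : D → Matrix ι ι ℝ} {k : ℕ∞ω} (h : ContDiff ℝ k A) : ContDiff ℝ k (fun x => (A x)ᵀ) :=
  (transposeCLM ι).contDiff.comp h

end Bilinear

theorem HasDerivAt.prod_fst {E F : Type*} [NormedAddCommGroup E] [NormedSpace ℝ E]
    [NormedAddCommGroup F] [NormedSpace ℝ F] {q : ℝ → E × F} {v : E × F} {t : ℝ}
    (h : HasDerivAt q v t) : HasDerivAt (fun s => (q s).1) v.1 t :=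
  (ContinuousLinearMap.fst ℝ E F).hasFDerivAt.comp_hasDerivAt t h

theorem HasDerivAt.prod_snd {E F : Type*} [NormedAddCommGroup E] [NormedSpace ℝ E]
    [NormedAddCommGroup F] [NormedSpace ℝ F] {q : ℝ → E × F} {v : E × F} {t : ℝ}
    (h : HasDerivAt q v t) : HasDerivAt (fun s => (q s).2) v.2 t :=
  (ContinuousLinearMap.snd ℝ E F).hasFDerivAt.comp_hasDerivAt t h

/-! ### Wedge products and the scalar product on `so(n)`. -/

namespace RubberRolling

variable {n : ℕ}

theorem So.transpose (X : So n) : (X : Mat n)ᵀ = -(X : Mat n) :=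
  (LieAlgebra.Orthogonal.mem_so (Fin n) ℝ (X : Mat n)).1 X.2

theorem dotProduct_mulVec_skew (X : So n) (x y : Vec n) :
    x ⬝ᵥ (X : Mat n) *ᵥ y = -(((X : Mat n) *ᵥ x) ⬝ᵥ y) := by
  rw [Matrix.dotProduct_mulVec, ← Matrix.mulVec_transpose, So.transpose, Matrix.neg_mulVec,
    neg_dotProduct]

theorem dotProduct_transpose_mulVec (A : Mat n) (x y : Vec n) :
    x ⬝ᵥ Aᵀ *ᵥ y = (A *ᵥ x) ⬝ᵥ y := by
  rw [Matrix.dotProduct_mulVec, Matrix.vecMul_transpose]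

theorem coe_wedge (x y : Vec n) :
    (wedge x y : Mat n) = Matrix.vecMulVec x y - Matrix.vecMulVec y x := rfl

theorem wedge_mulVec (x y z : Vec n) :
    (wedge x y : Mat n) *ᵥ z = (y ⬝ᵥ z) • x - (x ⬝ᵥ z) • y := by
  rw [coe_wedge, Matrix.sub_mulVec, Matrix.vecMulVec_mulVec, Matrix.vecMulVec_mulVec]
  simp

theorem isBilinearMap_wedge : IsBilinearMap ℝ (wedge : Vec n → Vec n → So n) where
  add_left := fun x y z => Subtype.ext <| by
    change _ = (wedge x z : Mat n) + (wedge y z : Mat n)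
    simp only [coe_wedge, Matrix.add_vecMulVec, Matrix.vecMulVec_add]; abel
  smul_left := fun c x y => Subtype.ext <| by
    simp [coe_wedge, Matrix.smul_vecMulVec, Matrix.vecMulVec_smul, smul_sub]
  add_right := fun x y z => Subtype.ext <| by
    change _ = (wedge x y : Mat n) + (wedge x z : Mat n)
    simp only [coe_wedge, Matrix.add_vecMulVec, Matrix.vecMulVec_add]; abel
  smul_right := fun c x y => Subtype.ext <| by
    simp [coe_wedge, Matrix.smul_vecMulVec, Matrix.vecMulVec_smul, smul_sub]

theorem isBilinearMap_coe_wedge :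
    IsBilinearMap ℝ (fun x y : Vec n => (wedge x y : Mat n)) where
  add_left := fun x y z => by rw [isBilinearMap_wedge.add_left]; rfl
  smul_left := fun c x y => by rw [isBilinearMap_wedge.smul_left]; rfl
  add_right := fun x y z => by rw [isBilinearMap_wedge.add_right]; rfl
  smul_right := fun c x y => by rw [isBilinearMap_wedge.smul_right]; rfl

theorem wedge_self (x : Vec n) : wedge x x = 0 := Subtype.ext (sub_self _)

theorem wedge_swap (x y : Vec n) : wedge y x = -wedge x y := Subtype.ext (neg_sub _ _).symm

theorem wedge_smul (c : ℝ) (x y : Vec n) : wedge x (c • y) = c • wedge x y :=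
  isBilinearMap_wedge.smul_right c x y

theorem isBilinearMap_ip : IsBilinearMap ℝ (ip : So n → So n → ℝ) where
  add_left := fun X Y Z => by simp [ip, add_mul]; ring
  smul_left := fun c X Y => by simp [ip]; ring
  add_right := fun X Y Z => by simp [ip, mul_add]
  smul_right := fun c X Y => by simp [ip]; ring

theorem ip_comm (X Y : So n) : ip X Y = ip Y X := by
  rw [ip, ip, Matrix.trace_mul_comm]

theorem ip_wedge (X : So n) (x y : Vec n) : ip X (wedge x y) = x ⬝ᵥ (X : Mat n) *ᵥ y := by
  rw [ip, coe_wedge, mul_sub, Matrix.trace_sub, Matrix.mul_vecMulVec, Matrix.mul_vecMulVec,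
    Matrix.trace_vecMulVec, Matrix.trace_vecMulVec, dotProduct_mulVec_skew,
    dotProduct_comm _ x, dotProduct_mulVec_skew]
  have : (X : Mat n) *ᵥ y ⬝ᵥ x = - ((X : Mat n) *ᵥ x ⬝ᵥ y) := by
    rw [dotProduct_comm, dotProduct_mulVec_skew]
  linarith

theorem ip_wedge_wedge (x y z w : Vec n) :
    ip (wedge x y) (wedge z w) = (x ⬝ᵥ z) * (y ⬝ᵥ w) - (x ⬝ᵥ w) * (y ⬝ᵥ z) := by
  rw [ip_wedge, wedge_mulVec, dotProduct_sub, dotProduct_smul, dotProduct_smul,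
    dotProduct_comm z x, dotProduct_comm z y, smul_eq_mul, smul_eq_mul]
  ring

/-- For a unit vector `γ` orthogonal to `a` and `b`: `[γ ∧ a, γ ∧ b] = -a ∧ b`. -/
theorem wedge_commutator {γ a b : Vec n} (hγ : γ ⬝ᵥ γ = 1) (ha : a ⬝ᵥ γ = 0) (hb : b ⬝ᵥ γ = 0) :
    (wedge γ a : Mat n) * (wedge γ b : Mat n) - (wedge γ b : Mat n) * (wedge γ a : Mat n)
      = -(wedge a b : Mat n) := by
  have ha' : γ ⬝ᵥ a = 0 := by rw [dotProduct_comm, ha]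
  have hb' : γ ⬝ᵥ b = 0 := by rw [dotProduct_comm, hb]
  simp only [coe_wedge, sub_mul, mul_sub, Matrix.vecMulVec_mul_vecMulVec, hγ, ha, hb, ha', hb',
    dotProduct_comm b a]
  simp only [zero_smul, one_smul, Matrix.vecMulVec_smul, Matrix.vecMulVec_zero]
  abel

theorem conj_skew (g : Mat n) (X : So n) : (g * (X : Mat n) * gᵀ)ᵀ = -(g * (X : Mat n) * gᵀ) := by
  simp [Matrix.transpose_mul, So.transpose, mul_assoc]

/-- A skew-symmetric matrix orthogonal to `x ∧ y` for all `x, y ⟂ γ` is of the form `γ ∧ u`. -/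
theorem eq_wedge_of_ip_eq_zero {γ : Vec n} (hγ : γ ⬝ᵥ γ = 1) (w : So n)
    (h : ∀ x y : Vec n, x ⬝ᵥ γ = 0 → y ⬝ᵥ γ = 0 → ip w (wedge x y) = 0) :
    w = wedge γ (-((w : Mat n) *ᵥ γ)) := by
  have hγw : γ ⬝ᵥ (w : Mat n) *ᵥ γ = 0 := by
    have := dotProduct_mulVec_skew w γ γ
    rw [dotProduct_comm _ γ] at this
    linarith
  have key : ∀ x y : Vec n, x ⬝ᵥ (w : Mat n) *ᵥ y
      = x ⬝ᵥ (wedge γ (-((w : Mat n) *ᵥ γ)) : Mat n) *ᵥ y := by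
    intro x y
    -- The form `x ⬝ᵥ w y` vanishes on the parts of `x` and `y` orthogonal to `γ`, so it is
    -- determined by `w γ`; and `γ ∧ (-w γ)` sends `γ` to `w γ`.
    have h1 := h (x - (x ⬝ᵥ γ) • γ) (y - (y ⬝ᵥ γ) • γ)
      (by simp [sub_dotProduct, hγ]) (by simp [sub_dotProduct, hγ])
    rw [ip_wedge, Matrix.mulVec_sub, Matrix.mulVec_smul] at h1
    simp only [sub_dotProduct, dotProduct_sub, smul_dotProduct, dotProduct_smul, smul_eq_mul,
      hγw] at h1
    rw [dotProduct_mulVec_skew w γ y] at h1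
    rw [wedge_mulVec]
    simp only [dotProduct_sub, dotProduct_smul, neg_dotProduct, dotProduct_neg, smul_eq_mul]
    rw [dotProduct_comm γ y]
    linarith
  apply Subtype.ext
  refine Matrix.ext_iff_mulVec.2 fun y => dotProduct_eq _ _ fun x => ?_
  rw [dotProduct_comm, key, dotProduct_comm]

end RubberRolling

/-! ### The configuration space, the constraints and horizontal lifts. -/

namespace RubberRolling

namespace Ball

variable {n : ℕ} (B : Ball n)

theorem sgn_mul_self : B.sgn * B.sgn = 1 := by
  rw [sgn]; cases B.variant <;> simp [RollingCase.sign]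

/-- The strict inequality between the radii excludes `σ = ρ` when the sign is negative. In the shell
variant `σ ± ρ` is negative. -/
theorem radius_ne_zero : B.radius ≠ 0 := by
  have h := B.admissible
  have hσ := B.σ_pos
  have hρ := B.ρ_pos
  rw [radius, sgn]
  cases hv : B.variant <;> rw [hv] at h <;> simp only [RollingCase.Admissible] at h <;>
    simp only [RollingCase.sign]
  · positivity
  · intro h0; linarith
  · intro h0; linarith

theorem eps_ne_zero : B.eps ≠ 0 := div_ne_zero B.σ_pos.ne' B.radius_ne_zero

theorem sgn_mul_rho : B.sgn * B.ρ = B.radius * (1 - B.eps) := by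
  have := B.radius_ne_zero
  rw [eps, mul_sub, mul_div_cancel₀ _ this, radius]
  ring

theorem D_eq : B.D = B.mass * (B.sgn * B.ρ) ^ 2 := by
  rw [D, mul_pow, pow_two B.sgn, sgn_mul_self, one_mul]

section Configuration

variable {B} {q : Amb n}

theorem transpose_mul_self (hq : q ∈ B.config) : q.1ᵀ * q.1 = 1 :=
  Matrix.mem_orthogonalGroup_iff' (Fin n) ℝ |>.1 (Matrix.mem_specialOrthogonalGroup_iff.1 hq.1).1

theorem mul_transpose_self (hq : q ∈ B.config) : q.1 * q.1ᵀ = 1 :=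
  Matrix.mem_orthogonalGroup_iff (Fin n) ℝ |>.1 (Matrix.mem_specialOrthogonalGroup_iff.1 hq.1).1

theorem mulVec_proj (hq : q ∈ B.config) : q.1 *ᵥ B.proj q = B.normal q := by
  rw [proj, Matrix.mulVec_mulVec, mul_transpose_self hq, Matrix.one_mulVec]

theorem radius_smul_mulVec_proj (hq : q ∈ B.config) : B.radius • (q.1 *ᵥ B.proj q) = q.2 := by
  rw [mulVec_proj hq, normal, smul_smul, mul_inv_cancel₀ B.radius_ne_zero, one_smul]

theorem mulVec_dotProduct_mulVec (hq : q ∈ B.config) (x y : Vec n) :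
    (q.1 *ᵥ x) ⬝ᵥ (q.1 *ᵥ y) = x ⬝ᵥ y := by
  rw [← dotProduct_transpose_mulVec, Matrix.mulVec_mulVec, transpose_mul_self hq,
    Matrix.one_mulVec]

theorem proj_dotProduct_self (hq : q ∈ B.config) : B.proj q ⬝ᵥ B.proj q = 1 := by
  have := B.radius_ne_zero
  rw [← mulVec_dotProduct_mulVec hq, mulVec_proj hq, normal, smul_dotProduct, dotProduct_smul,
    hq.2, smul_eq_mul, smul_eq_mul]
  field_simp

end Configuration

/-- The horizontal vector at `q = (g, r)` with `ġ = g (γ ∧ u)`, where `γ = π q`. -/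
noncomputable def horizontalVec (q : Amb n) (u : Vec n) : Amb n :=
  (q.1 * (wedge (B.proj q) u : Mat n), -(B.sgn * B.ρ) • (q.1 *ᵥ u))

variable {B} in
-- No twisting leaves only `ω = γ ∧ u`, and then `Ω Γ = g ω γ = -g u` fixes `V`. So the distribution
-- is parametrised by the tangent space of the sphere at `γ`.
theorem mem_distribution_iff {q : Amb n} (hq : q ∈ B.config) (v : Amb n) :
    v ∈ B.distribution q ↔ ∃ u : Vec n, u ⬝ᵥ B.proj q = 0 ∧ v = B.horizontalVec q u := by
  have hγ := proj_dotProduct_self hq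
  have hV : ∀ u : Vec n, u ⬝ᵥ B.proj q = 0 →
      (B.sgn * B.ρ) • ((q.1 * (wedge (B.proj q) u : Mat n) * q.1ᵀ) *ᵥ B.normal q)
        = -(B.sgn * B.ρ) • (q.1 *ᵥ u) := by
    intro u hu
    rw [← Matrix.mulVec_mulVec, ← proj, ← Matrix.mulVec_mulVec, wedge_mulVec, hu, hγ]
    simp [Matrix.mulVec_neg]
  constructor
  · rintro ⟨w, h1, h2, h3⟩
    have hw := eq_wedge_of_ip_eq_zero hγ w h3
    have hu : (-((w : Mat n) *ᵥ B.proj q)) ⬝ᵥ B.proj q = 0 := by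
      have := dotProduct_mulVec_skew w (B.proj q) (B.proj q)
      rw [dotProduct_comm] at this
      rw [neg_dotProduct]
      linarith
    refine ⟨_, hu, Prod.ext ?_ ?_⟩
    · rw [h1]; exact congrArg (fun X : So n => q.1 * (X : Mat n)) hw
    · rw [h2]
      refine Eq.trans ?_ (hV _ hu)
      rw [← hw]
  · rintro ⟨u, hu, rfl⟩
    refine ⟨wedge (B.proj q) u, rfl, (hV u hu).symm, fun x y hx hy => ?_⟩
    rw [ip_wedge_wedge, dotProduct_comm _ x, dotProduct_comm (B.proj q) y, hx, hy]
    ring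

/-! ### Derivatives of the projection and of the Lagrangian -/

theorem contDiff_normal {k : ℕ∞ω} : ContDiff ℝ k B.normal := contDiff_snd.const_smul B.radius⁻¹

theorem contDiff_proj {k : ℕ∞ω} : ContDiff ℝ k B.proj := by
  have h : ContDiff ℝ k (fun q : Amb n => q.1ᵀ *ᵥ B.normal q) :=
    isBilinearMap_mulVec.contDiff contDiff_fst.matrix_transpose B.contDiff_normal
  exact h

theorem hasDerivAt_proj {q : ℝ → Amb n} {v : Amb n} {t : ℝ} (h : HasDerivAt q v t) :
    HasDerivAt (fun s => B.proj (q s)) (v.1ᵀ *ᵥ B.normal (q t) + (q t).1ᵀ *ᵥ B.normal v) t :=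
  isBilinearMap_mulVec.hasDerivAt h.prod_fst.matrix_transpose (h.prod_snd.const_smul B.radius⁻¹)

theorem hasDerivAt_line {E : Type*} [NormedAddCommGroup E] [NormedSpace ℝ E] (x v : E) :
    HasDerivAt (fun s : ℝ => x + s • v) v 0 := by
  simpa using ((hasDerivAt_id (0 : ℝ)).smul_const v).const_add x

theorem fderiv_proj (q v : Amb n) :
    fderiv ℝ B.proj q v = v.1ᵀ *ᵥ B.normal q + q.1ᵀ *ᵥ B.normal v := by
  refine fderiv_apply_of_hasDerivAt_line
    (B.contDiff_proj (k := 1)).contDiffAt.differentiableAt_one ?_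
  simpa using B.hasDerivAt_proj (hasDerivAt_line q v)

variable {B} in
-- The rotation of the body frame contributes `u`, the motion of the centre `-(1 - ε) u`.
theorem fderiv_proj_horizontalVec {q : Amb n} (hq : q ∈ B.config) {u : Vec n}
    (hu : u ⬝ᵥ B.proj q = 0) : fderiv ℝ B.proj q (B.horizontalVec q u) = B.eps • u := by
  have hr := B.radius_ne_zero
  rw [fderiv_proj, ← mulVec_proj hq]
  simp only [horizontalVec, normal, Matrix.transpose_mul, So.transpose, neg_mul,
    Matrix.neg_mulVec, ← Matrix.mulVec_mulVec, Matrix.mulVec_smul]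
  rw [Matrix.mulVec_mulVec _ q.1ᵀ q.1, Matrix.mulVec_mulVec _ q.1ᵀ q.1, transpose_mul_self hq,
    Matrix.one_mulVec, Matrix.one_mulVec, wedge_mulVec, hu, proj_dotProduct_self hq, sgn_mul_rho,
    smul_smul]
  have : B.radius⁻¹ * -(B.radius * (1 - B.eps)) = B.eps - 1 := by field_simp; ring
  rw [this, sub_smul]
  simp

variable {B} in
theorem isHorizontalLift_iff {q : Amb n} (hq : q ∈ B.config) {ξ : Vec n}
    (hξ : ξ ⬝ᵥ B.proj q = 0) (v : Amb n) :
    B.IsHorizontalLift q ξ v ↔ v = B.horizontalVec q (B.eps⁻¹ • ξ) := by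
  have hξ' : (B.eps⁻¹ • ξ) ⬝ᵥ B.proj q = 0 := by rw [smul_dotProduct, hξ, smul_zero]
  rw [IsHorizontalLift, mem_distribution_iff hq]
  constructor
  · rintro ⟨⟨u, hu, rfl⟩, h⟩
    rw [fderiv_proj_horizontalVec hq hu] at h
    rw [← h, smul_smul, inv_mul_cancel₀ B.eps_ne_zero, one_smul]
  · rintro rfl
    refine ⟨⟨_, hξ', rfl⟩, ?_⟩
    rw [fderiv_proj_horizontalVec hq hξ', smul_smul, mul_inv_cancel₀ B.eps_ne_zero, one_smul]

variable {B} in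
theorem horizontalLift_eq {q : Amb n} (hq : q ∈ B.config) {ξ : Vec n}
    (hξ : ξ ⬝ᵥ B.proj q = 0) : B.horizontalLift q ξ = B.horizontalVec q (B.eps⁻¹ • ξ) :=
  (isHorizontalLift_iff hq hξ _).1
    (Classical.epsilon_spec ⟨_, (isHorizontalLift_iff hq hξ _).2 rfl⟩)

variable {B} in
theorem existsUnique_isHorizontalLift {q : Amb n} (hq : q ∈ B.config) {ξ : Vec n}
    (hξ : ξ ⬝ᵥ B.proj q = 0) : ∃! v, B.IsHorizontalLift q ξ v :=
  ⟨_, (isHorizontalLift_iff hq hξ _).2 rfl, fun v hv => (isHorizontalLift_iff hq hξ v).1 hv⟩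

/-- The kinetic energy of rotation, as a bilinear form on all matrices. -/
noncomputable def inertiaForm (A C : Mat n) : ℝ := ip (B.inertia (skewPart A)) (skewPart C)

theorem skewPart_add (A C : Mat n) : skewPart (A + C) = skewPart A + skewPart C := by
  apply Subtype.ext
  change (1 / 2 : ℝ) • (A + C - (A + C)ᵀ) = (1 / 2 : ℝ) • (A - Aᵀ) + (1 / 2 : ℝ) • (C - Cᵀ)
  rw [Matrix.transpose_add, ← smul_add]
  congr 1
  abel

theorem skewPart_smul (c : ℝ) (A : Mat n) : skewPart (c • A) = c • skewPart A := by
  apply Subtype.ext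
  change (1 / 2 : ℝ) • (c • A - (c • A)ᵀ) = c • ((1 / 2 : ℝ) • (A - Aᵀ))
  rw [Matrix.transpose_smul, ← smul_sub, smul_comm]

theorem isBilinearMap_inertiaForm : IsBilinearMap ℝ B.inertiaForm where
  add_left := fun A C E => by
    rw [inertiaForm, skewPart_add, map_add, isBilinearMap_ip.add_left]; rfl
  smul_left := fun c A C => by
    rw [inertiaForm, skewPart_smul, map_smul, isBilinearMap_ip.smul_left]; rfl
  add_right := fun A C E => by rw [inertiaForm, skewPart_add, isBilinearMap_ip.add_right]; rfl
  smul_right := fun c A C => by rw [inertiaForm, skewPart_smul, isBilinearMap_ip.smul_right]; rfl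

theorem inertiaForm_comm (A C : Mat n) : B.inertiaForm A C = B.inertiaForm C A := by
  rw [inertiaForm, B.inertia_symm, ip_comm]; rfl

theorem inertiaForm_coe (X Y : So n) :
    B.inertiaForm (X : Mat n) (Y : Mat n) = ip (B.inertia X) Y := by
  rw [inertiaForm, skewPart_coe, skewPart_coe]

theorem ip_modInertia (X Y : So n) : ip (B.modInertia X) Y = ip (B.inertia X) Y + B.D * ip X Y := by
  rw [modInertia, LinearMap.add_apply, isBilinearMap_ip.add_left, LinearMap.smul_apply,
    LinearMap.id_apply, isBilinearMap_ip.smul_left, smul_eq_mul]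

/-- Freezing `q` or `v` in this formula yields the two partial derivatives of the Lagrangian. -/
theorem hasDerivAt_lagrangian {q v : ℝ → Amb n} {q' v' : Amb n} {t : ℝ}
    (hq : HasDerivAt q q' t) (hv : HasDerivAt v v' t) :
    HasDerivAt (fun s => B.lagrangian (q s) (v s))
      (B.inertiaForm ((q t).1ᵀ * (v t).1) (q'.1ᵀ * (v t).1 + (q t).1ᵀ * v'.1)
        + B.mass * ((v t).2 ⬝ᵥ v'.2)) t := by
  have h1 := isBilinearMap_matrix_mul.hasDerivAt hq.prod_fst.matrix_transpose hv.prod_fst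
  have h2 := B.isBilinearMap_inertiaForm.hasDerivAt h1 h1
  have h3 := isBilinearMap_dotProduct.hasDerivAt hv.prod_snd hv.prod_snd
  refine ((h2.const_mul (1 / 2)).add (h3.const_mul (1 / 2 * B.mass))).congr_deriv ?_
  rw [inertiaForm_comm B _ ((q t).1ᵀ * (v t).1), dotProduct_comm v'.2]
  ring

theorem contDiff_lagrangian {k : ℕ∞ω} :
    ContDiff ℝ k (fun p : Amb n × Amb n => B.lagrangian p.1 p.2) := by
  have h1 : ContDiff ℝ k (fun p : Amb n × Amb n => p.1.1ᵀ * p.2.1) :=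
    isBilinearMap_matrix_mul.contDiff (contDiff_fst.fst.matrix_transpose) contDiff_snd.fst
  have h2 := B.isBilinearMap_inertiaForm.contDiff h1 h1
  have h3 : ContDiff ℝ k (fun p : Amb n × Amb n => p.2.2 ⬝ᵥ p.2.2) :=
    isBilinearMap_dotProduct.contDiff contDiff_snd.snd contDiff_snd.snd
  exact (contDiff_const.mul h2).add (contDiff_const.mul h3)

theorem fderiv_lagrangian_velocity (q v δ : Amb n) :
    fderiv ℝ (fun w => B.lagrangian q w) v δ
      = B.inertiaForm (q.1ᵀ * v.1) (q.1ᵀ * δ.1) + B.mass * (v.2 ⬝ᵥ δ.2) := by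
  refine fderiv_apply_of_hasDerivAt_line
    ((B.contDiff_lagrangian (k := 1)).comp
      (contDiff_const.prodMk contDiff_id)).contDiffAt.differentiableAt_one ?_
  simpa using B.hasDerivAt_lagrangian (hasDerivAt_const (0 : ℝ) q) (hasDerivAt_line v δ)

theorem fderiv_lagrangian_position (q v δ : Amb n) :
    fderiv ℝ (fun x => B.lagrangian x v) q δ
      = B.inertiaForm (q.1ᵀ * v.1) (δ.1ᵀ * v.1) := by
  refine fderiv_apply_of_hasDerivAt_line
    ((B.contDiff_lagrangian (k := 1)).comp
      (contDiff_id.prodMk contDiff_const)).contDiffAt.differentiableAt_one ?_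
  simpa using B.hasDerivAt_lagrangian (hasDerivAt_line q δ) (hasDerivAt_const (0 : ℝ) v)

variable {B} in
-- Since `|γ ∧ u|² = |u|²`, the translational term `m ρ² |u|²` equals `D ⟨γ ∧ u, γ ∧ u⟩` and merges
-- into `𝐈`.
theorem lagrangian_horizontalLift {q : Amb n} (hq : q ∈ B.config) {ξ : Vec n}
    (hξ : ξ ⬝ᵥ B.proj q = 0) :
    B.lagrangian q (B.horizontalLift q ξ) = B.reducedLagrangian (B.proj q) ξ := by
  have hε := B.eps_ne_zero
  rw [horizontalLift_eq hq hξ, lagrangian, reducedLagrangian, horizontalVec, wedge_smul]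
  simp only
  rw [← mul_assoc, transpose_mul_self hq, one_mul, skewPart_coe, ip_modInertia, map_smul,
    isBilinearMap_ip.smul_left, isBilinearMap_ip.smul_right, smul_dotProduct, dotProduct_smul,
    mulVec_dotProduct_mulVec hq, smul_dotProduct, dotProduct_smul, ip_wedge_wedge,
    proj_dotProduct_self hq, hξ, D_eq]
  simp only [smul_eq_mul]
  field_simp
  ring

end Ball

end RubberRolling

namespace RubberRolling

variable {n : ℕ}

/-! ### Curves of rotations -/

section Rotation

variable {J : Set ℝ} {W g h : ℝ → Mat n} {t₀ : ℝ}

theorem hasDerivAt_mul_transpose {t : ℝ} (hW : (W t)ᵀ = -W t)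
    (hg : HasDerivAt g (g t * W t) t) (hh : HasDerivAt h (h t * W t) t) :
    HasDerivAt (fun s => g s * (h s)ᵀ) 0 t := by
  refine (isBilinearMap_matrix_mul.hasDerivAt hg hh.matrix_transpose).congr_deriv ?_
  simp [Matrix.transpose_mul, hW, mul_assoc]

/-- The terms `g W hᵀ` and `g Wᵀ hᵀ` cancel. With `h = g` this preserves orthogonality; with two
lifts of one curve it gives uniqueness. -/
theorem mul_transpose_eq (hJ : IsOpen J) (hJ' : J.OrdConnected)
    (hW : ∀ t ∈ J, (W t)ᵀ = -W t) (hg : ∀ t ∈ J, HasDerivAt g (g t * W t) t)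
    (hh : ∀ t ∈ J, HasDerivAt h (h t * W t) t) (ht₀ : t₀ ∈ J) {t : ℝ} (ht : t ∈ J) :
    g t * (h t)ᵀ = g t₀ * (h t₀)ᵀ := by
  have hd := fun s (hs : s ∈ J) => hasDerivAt_mul_transpose (hW s hs) (hg s hs) (hh s hs)
  exact hJ.is_const_of_deriv_eq_zero hJ'.isPreconnected
    (fun s hs => (hd s hs).differentiableAt.differentiableWithinAt) (fun s hs => (hd s hs).deriv)
    ht ht₀

/-- A continuous curve of angular velocities in the body frame determines a curve of rotations. -/
theorem exists_rotation_curve (hJ : IsOpen J) (hJ' : J.OrdConnected) (hWc : ContinuousOn W J)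
    (hW : ∀ t ∈ J, (W t)ᵀ = -W t) (ht₀ : t₀ ∈ J) {g₀ : Mat n}
    (hg₀ : g₀ ∈ Matrix.specialOrthogonalGroup (Fin n) ℝ) :
    ∃ g : ℝ → Mat n, g t₀ = g₀ ∧ ∀ t ∈ J,
      g t ∈ Matrix.specialOrthogonalGroup (Fin n) ℝ ∧ HasDerivAt g (g t * W t) t := by
  rw [Matrix.mem_specialOrthogonalGroup_iff, Matrix.mem_orthogonalGroup_iff] at hg₀
  obtain ⟨g, hgt₀, hg⟩ := exists_hasDerivAt_linear
    (A := fun t => (isBilinearMap_matrix_mul (ι := Fin n)).toContinuousBilinearMap.flip (W t))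
    hJ hJ' ((ContinuousLinearMap.continuous _).comp_continuousOn hWc) ht₀ g₀
  replace hg : ∀ t ∈ J, HasDerivAt g (g t * W t) t := hg
  have horth : ∀ t ∈ J, g t * (g t)ᵀ = 1 := fun t ht => by
    rw [mul_transpose_eq hJ hJ' hW hg hg ht₀ ht, hgt₀, hg₀.1]
  have hdet : ContinuousOn (fun t => (g t).det) J :=
    (continuous_id.matrix_det).comp_continuousOn
      fun t ht => (hg t ht).continuousAt.continuousWithinAt
  -- The determinant is continuous with square `1` on a connected set, hence constant, and it is `1`
  -- at `t₀`.
  have hsq : Set.EqOn ((fun t => (g t).det) ^ 2) 1 J := fun t ht => by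
    have := congrArg Matrix.det (horth t ht)
    rw [Matrix.det_mul, Matrix.det_transpose, Matrix.det_one] at this
    simpa [pow_two] using this
  have hone : ∀ t ∈ J, (g t).det = 1 := by
    rcases hJ'.isPreconnected.eq_one_or_eq_neg_one_of_sq_eq hdet hsq with h | h
    · exact h
    · have := h ht₀
      simp only [hgt₀, hg₀.2, Pi.neg_apply, Pi.one_apply] at this
      norm_num at this
  refine ⟨g, hgt₀, fun t ht => ⟨?_, hg t ht⟩⟩
  rw [Matrix.mem_specialOrthogonalGroup_iff, Matrix.mem_orthogonalGroup_iff]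
  exact ⟨horth t ht, hone t ht⟩

end Rotation

theorem conj_wedge (g : Mat n) (x y : Vec n) :
    g * (wedge x y : Mat n) * gᵀ = (wedge (g *ᵥ x) (g *ᵥ y) : Mat n) := by
  rw [coe_wedge, coe_wedge, mul_sub, sub_mul, Matrix.mul_vecMulVec, Matrix.mul_vecMulVec,
    Matrix.vecMulVec_mul, Matrix.vecMulVec_mul, Matrix.vecMul_transpose, Matrix.vecMul_transpose]

/-! ### The connection form, its curvature and the momentum pairing. -/

namespace Ball

variable {B : Ball n}

/-- Horizontal vectors are velocities of curves in the configuration space. -/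
theorem exists_config_curve {q v : Amb n} (hq : q ∈ B.config) (hv : v ∈ B.distribution q) :
    ∃ c : ℝ → Amb n, c 0 = q ∧ (∀ s, c s ∈ B.config) ∧ HasDerivAt c v 0 := by
  obtain ⟨w, h1, h2, -⟩ := hv
  obtain ⟨g, hg0, hg⟩ := exists_rotation_curve (J := Set.univ) (W := fun _ => (w : Mat n))
    isOpen_univ Set.ordConnected_univ continuousOn_const (fun _ _ => So.transpose w)
    (Set.mem_univ 0) hq.1
  -- A second rotation curve moves `r` within its sphere; its generator `±ρ (σ ± ρ)⁻¹ Ω` gives the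
  -- initial velocity `±ρ Ω Γ`.
  obtain ⟨h, hh0, hh⟩ := exists_rotation_curve (J := Set.univ)
    (W := fun _ => (B.sgn * B.ρ * B.radius⁻¹) • (q.1 * (w : Mat n) * q.1ᵀ))
    isOpen_univ Set.ordConnected_univ continuousOn_const
    (fun _ _ => by rw [Matrix.transpose_smul, conj_skew, smul_neg])
    (Set.mem_univ 0) (one_mem _)
  refine ⟨fun s => (g s, h s *ᵥ q.2), ?_, fun s => ⟨(hg s trivial).1, ?_⟩, ?_⟩
  · simp [hg0, hh0]
  · have ho := (Matrix.mem_specialOrthogonalGroup_iff.1 (hh s trivial).1).1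
    rw [Matrix.mem_orthogonalGroup_iff'] at ho
    rw [← hq.2, ← dotProduct_transpose_mulVec, Matrix.mulVec_mulVec, ho, Matrix.one_mulVec]
  · have hd := isBilinearMap_mulVec.hasDerivAt (hh 0 trivial).2 (hasDerivAt_const (0 : ℝ) q.2)
    refine ((hg 0 trivial).2.prodMk hd).congr_deriv (Prod.ext ?_ ?_)
    · simp [hg0, h1]
    · simp only [hh0, h2, one_mul, Matrix.mulVec_zero, add_zero, normal, Matrix.smul_mulVec,
        Matrix.mulVec_smul, smul_smul]

variable (B) in
/-- The connection form of the constraints, extended to the ambient space. -/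
noncomputable def connectionForm (q v : Amb n) : Mat n :=
  v.1 * q.1ᵀ - B.eps⁻¹ • (wedge (B.normal q) (q.1 *ᵥ fderiv ℝ B.proj q v) : Mat n)

theorem contDiff_connectionForm {k : ℕ} :
    ContDiff ℝ k (fun p : Amb n × Amb n => B.connectionForm p.1 p.2) := by
  have h1 : ContDiff ℝ k (fun p : Amb n × Amb n => fderiv ℝ B.proj p.1 p.2) :=
    (B.contDiff_proj (k := ω)).contDiff_fderiv_apply le_top
  have h2 : ContDiff ℝ k (fun p : Amb n × Amb n => p.1.1 *ᵥ fderiv ℝ B.proj p.1 p.2) :=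
    isBilinearMap_mulVec.contDiff contDiff_fst.fst h1
  have h3 : ContDiff ℝ k (fun p : Amb n × Amb n => B.normal p.1) :=
    B.contDiff_normal.comp contDiff_fst
  have h4 : ContDiff ℝ k (fun p : Amb n × Amb n => p.2.1 * p.1.1ᵀ) :=
    isBilinearMap_matrix_mul.contDiff contDiff_snd.fst contDiff_fst.fst.matrix_transpose
  exact h4.sub ((isBilinearMap_coe_wedge.contDiff h3 h2).const_smul _)

theorem connectionForm_add (q v w : Amb n) :
    B.connectionForm q (v + w) = B.connectionForm q v + B.connectionForm q w := by
  simp only [connectionForm, Prod.fst_add, add_mul, map_add, Matrix.mulVec_add]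
  rw [isBilinearMap_coe_wedge.add_right, smul_add]
  abel

theorem connectionForm_smul (q : Amb n) (c : ℝ) (v : Amb n) :
    B.connectionForm q (c • v) = c • B.connectionForm q v := by
  simp only [connectionForm, Prod.smul_fst, Matrix.smul_mul, map_smul, Matrix.mulVec_smul]
  rw [isBilinearMap_coe_wedge.smul_right, smul_sub, smul_comm c]

theorem connectionForm_sub (q v w : Amb n) :
    B.connectionForm q (v - w) = B.connectionForm q v - B.connectionForm q w := by
  rw [sub_eq_add_neg, ← neg_one_smul ℝ w, connectionForm_add, connectionForm_smul]
  simp [sub_eq_add_neg]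

theorem connectionForm_of_mem_distribution {q v : Amb n} (hq : q ∈ B.config)
    (hv : v ∈ B.distribution q) : B.connectionForm q v = 0 := by
  obtain ⟨u, hu, rfl⟩ := (mem_distribution_iff hq v).1 hv
  rw [connectionForm, fderiv_proj_horizontalVec hq hu, horizontalVec]
  simp only
  rw [conj_wedge, mulVec_proj hq, Matrix.mulVec_smul, isBilinearMap_coe_wedge.smul_right,
    smul_smul, inv_mul_cancel₀ B.eps_ne_zero, one_smul, sub_self]

/-- The projection is invariant under the action, so only the term `ġ gᵀ = η g gᵀ` remains. -/
theorem connectionForm_generator {q : Amb n} (hq : q ∈ B.config) (η : So n) :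
    B.connectionForm q (generator η q) = η := by
  have h : fderiv ℝ B.proj q (generator η q) = 0 := by
    rw [fderiv_proj]
    simp only [generator, normal, Matrix.transpose_mul, So.transpose, Matrix.mulVec_smul,
      ← Matrix.mulVec_mulVec, Matrix.neg_mulVec, Matrix.mulVec_neg]
    simp
  rw [connectionForm, h, Matrix.mulVec_zero, generator]
  simp only
  rw [mul_assoc, mul_transpose_self hq, mul_one, ← zero_smul ℝ (0 : Vec n),
    isBilinearMap_coe_wedge.smul_right, zero_smul, smul_zero, sub_zero]

/-- Differentiate the identity "connection form of `X` is zero" along a curve in the configuration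
space with velocity `v`. The form is linear in its second argument, so the right side involves `X`
only through its value at `q`. -/
theorem connectionForm_fderiv {q v : Amb n} (hq : q ∈ B.config) (hv : v ∈ B.distribution q)
    {X : Amb n → Amb n} (hX : B.IsHorizontalField X) :
    B.connectionForm q (fderiv ℝ X q v)
      = -fderiv ℝ (fun p : Amb n × Amb n => B.connectionForm p.1 p.2) (q, X q) (v, 0) := by
  obtain ⟨c, hc0, hc, hcv⟩ := exists_config_curve hq hv
  have hd : ∀ p, DifferentiableAt ℝ (fun p : Amb n × Amb n => B.connectionForm p.1 p.2) p :=
    fun p => (contDiff_connectionForm (k := 1)).contDiffAt.differentiableAt_one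
  have hXd : HasDerivAt (fun s => X (c s)) (fderiv ℝ X q v) 0 := by
    subst hc0
    exact ((hX.1.differentiable (by simp)).differentiableAt.hasFDerivAt).comp_hasDerivAt 0 hcv
  have hz : (fun s => B.connectionForm (c s) (X (c s))) = fun _ => 0 :=
    funext fun s => connectionForm_of_mem_distribution (hc s) (hX.2 _ (hc s))
  have h0 : fderiv ℝ (fun p : Amb n × Amb n => B.connectionForm p.1 p.2) (c 0, X (c 0))
      (v, fderiv ℝ X q v) = 0 := by
    refine fderiv_apply_of_hasDerivAt (c := fun s => (c s, X (c s))) (hd _) (hcv.prodMk hXd) ?_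
    exact (hasDerivAt_const (0 : ℝ) (0 : Mat n)).congr_of_eventuallyEq
      (Filter.Eventually.of_forall fun s => congrFun hz s)
  have h1 : fderiv ℝ (fun p : Amb n × Amb n => B.connectionForm p.1 p.2) (q, X q)
      (0, fderiv ℝ X q v) = B.connectionForm q (fderiv ℝ X q v) := by
    refine fderiv_apply_of_hasDerivAt_line (hd _) ?_
    simp only [Prod.smul_mk, Prod.mk_add_mk, smul_zero, add_zero, connectionForm_add,
      connectionForm_smul]
    exact hasDerivAt_line _ _
  rw [hc0] at h0
  rw [← h1, eq_neg_iff_add_eq_zero, ← map_add]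
  simpa using h0

theorem lieBracket_amb (X Y : Amb n → Amb n) (q : Amb n) :
    VectorField.lieBracket ℝ X Y q = fderiv ℝ Y q (X q) - fderiv ℝ X q (Y q) := rfl

/-- The vertical component of the bracket of horizontal fields depends only on their values. -/
theorem isCurvature_unique {q v₁ v₂ : Amb n} (hq : q ∈ B.config) {η η' : So n}
    (h : B.IsCurvature q v₁ v₂ η) (h' : B.IsCurvature q v₁ v₂ η') : η = η' := by
  -- The connection form of the bracket is an exterior derivative of the form, expressed by `v₁` and
  -- `v₂` alone.
  have key : ∀ η, B.IsCurvature q v₁ v₂ η → (η : Mat n)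
      = -fderiv ℝ (fun p : Amb n × Amb n => B.connectionForm p.1 p.2) (q, v₁) (v₂, 0)
        + fderiv ℝ (fun p : Amb n × Amb n => B.connectionForm p.1 p.2) (q, v₂) (v₁, 0) := by
    rintro η ⟨X₁, X₂, hX₁, hX₂, rfl, rfl, hb⟩
    have := connectionForm_of_mem_distribution hq hb
    rw [connectionForm_sub, connectionForm_generator hq, lieBracket_amb,
      connectionForm_sub, connectionForm_fderiv hq (hX₂.2 q hq) hX₁,
      connectionForm_fderiv hq (hX₁.2 q hq) hX₂, sub_eq_zero] at this
    rw [← this, sub_neg_eq_add]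
  exact Subtype.ext ((key η h).trans (key η' h').symm)

variable (B) in
/-- A horizontal field on the ambient space: the lift of the projection of a constant vector to the
tangent spaces of the sphere. -/
noncomputable def horizontalField (a : Vec n) (q : Amb n) : Amb n :=
  (q.1 * (wedge (B.proj q) a : Mat n),
    (B.sgn * B.ρ) • (q.1 *ᵥ ((wedge (B.proj q) a : Mat n) *ᵥ B.proj q)))

theorem isHorizontalField_horizontalField (a : Vec n) :
    B.IsHorizontalField (B.horizontalField a) := by
  constructor
  · have h1 : ContDiff ℝ ∞ (fun q => (wedge (B.proj q) a : Mat n)) :=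
      isBilinearMap_coe_wedge.contDiff B.contDiff_proj contDiff_const
    have h2 : ContDiff ℝ ∞ (fun q => (wedge (B.proj q) a : Mat n) *ᵥ B.proj q) :=
      isBilinearMap_mulVec.contDiff h1 B.contDiff_proj
    exact (isBilinearMap_matrix_mul.contDiff contDiff_fst h1).prodMk
      ((isBilinearMap_mulVec.contDiff contDiff_fst h2).const_smul (B.sgn * B.ρ))
  · intro q hq
    have hγ := proj_dotProduct_self hq
    refine (mem_distribution_iff hq _).2 ⟨a - (a ⬝ᵥ B.proj q) • B.proj q, ?_, ?_⟩
    · simp [sub_dotProduct, hγ]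
    · rw [horizontalField, horizontalVec, wedge_mulVec, hγ, sub_eq_add_neg a, ← neg_smul,
        isBilinearMap_wedge.add_right, wedge_smul, wedge_self, smul_zero, add_zero, neg_smul,
        ← smul_neg, ← Matrix.mulVec_neg]
      congr 4
      simp [sub_eq_add_neg]

theorem horizontalField_eq {q : Amb n} (hq : q ∈ B.config) {a : Vec n}
    (ha : a ⬝ᵥ B.proj q = 0) : B.horizontalField a q = B.horizontalVec q a := by
  rw [horizontalField, horizontalVec, wedge_mulVec, ha, proj_dotProduct_self hq]
  simp [Matrix.mulVec_neg]

/-- Product rule with `g` moving by `g (γ ∧ a)` and `γ` by `ε a`. The second component is symmetric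
in `a` and `b`, so it drops out of brackets. -/
theorem fderiv_horizontalField {q : Amb n} (hq : q ∈ B.config) {a b : Vec n}
    (ha : a ⬝ᵥ B.proj q = 0) (hb : b ⬝ᵥ B.proj q = 0) :
    fderiv ℝ (B.horizontalField b) q (B.horizontalVec q a)
      = (q.1 * ((wedge (B.proj q) a : Mat n) * (wedge (B.proj q) b : Mat n)
          + B.eps • (wedge a b : Mat n)),
        (B.sgn * B.ρ * (B.eps - 1) * (a ⬝ᵥ b)) • (q.1 *ᵥ B.proj q)) := by
  have hl := hasDerivAt_line q (B.horizontalVec q a)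
  have hp := B.hasDerivAt_proj hl
  simp only [zero_smul, add_zero] at hp
  rw [← fderiv_proj, fderiv_proj_horizontalVec hq ha] at hp
  have h1 := isBilinearMap_coe_wedge.hasDerivAt hp (hasDerivAt_const (0 : ℝ) b)
  have h2 := isBilinearMap_mulVec.hasDerivAt h1 hp
  have h3 := isBilinearMap_matrix_mul.hasDerivAt hl.prod_fst h1
  have h4 := (isBilinearMap_mulVec.hasDerivAt hl.prod_fst h2).const_smul (B.sgn * B.ρ)
  refine fderiv_apply_of_hasDerivAt_line
    ((isHorizontalField_horizontalField b).1.differentiable (by simp)).differentiableAt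
    ((h3.prodMk h4).congr_deriv ?_)
  have hw0 : ∀ x : Vec n, (wedge x (0 : Vec n) : Mat n) = 0 := fun x => by
    rw [← zero_smul ℝ (0 : Vec n), isBilinearMap_coe_wedge.smul_right, zero_smul]
  have ha' : B.proj q ⬝ᵥ a = 0 := by rw [dotProduct_comm, ha]
  have hb' : B.proj q ⬝ᵥ b = 0 := by rw [dotProduct_comm, hb]
  have hγ := proj_dotProduct_self hq
  simp only [zero_smul, add_zero, hw0, horizontalVec, isBilinearMap_coe_wedge.smul_left]
  refine Prod.ext ?_ ?_
  · simp only [mul_add, mul_assoc]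
  · simp only [← Matrix.mulVec_mulVec, ← Matrix.mulVec_add, Matrix.smul_mulVec,
      Matrix.mulVec_smul, wedge_mulVec, ha, hb, ha', hb', hγ, dotProduct_sub, dotProduct_smul,
      dotProduct_comm b a]
    rw [mul_assoc (B.sgn * B.ρ), mul_smul (B.sgn * B.ρ),
      ← Matrix.mulVec_smul q.1 ((B.eps - 1) * (a ⬝ᵥ b))]
    congr 2
    module

/-- In the bracket of the model fields the motion of `γ` contributes `2ε u₂ ∧ u₁` and the commutator
`[γ ∧ u₂, γ ∧ u₁]` contributes `-u₂ ∧ u₁`. At `q` the bracket is exactly vertical. -/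
theorem isCurvature_horizontalVec {q : Amb n} (hq : q ∈ B.config) {u₁ u₂ : Vec n}
    (h₁ : u₁ ⬝ᵥ B.proj q = 0) (h₂ : u₂ ⬝ᵥ B.proj q = 0) :
    B.IsCurvature q (B.horizontalVec q u₁) (B.horizontalVec q u₂)
      ((2 * B.eps - 1) • wedge (q.1 *ᵥ u₂) (q.1 *ᵥ u₁)) := by
  refine ⟨_, _, isHorizontalField_horizontalField u₁, isHorizontalField_horizontalField u₂,
    horizontalField_eq hq h₁, horizontalField_eq hq h₂, ?_⟩
  have hz : VectorField.lieBracket ℝ (B.horizontalField u₂) (B.horizontalField u₁) q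
      = generator ((2 * B.eps - 1) • wedge (q.1 *ᵥ u₂) (q.1 *ᵥ u₁)) q := by
    rw [lieBracket_amb, horizontalField_eq hq h₁, horizontalField_eq hq h₂, fderiv_horizontalField hq h₂ h₁,
      fderiv_horizontalField hq h₁ h₂, generator]
    have hc : (((2 * B.eps - 1) • wedge (q.1 *ᵥ u₂) (q.1 *ᵥ u₁) : So n) : Mat n)
        = (2 * B.eps - 1) • (wedge (q.1 *ᵥ u₂) (q.1 *ᵥ u₁) : Mat n) := rfl
    have hs : (wedge u₁ u₂ : Mat n) = -(wedge u₂ u₁ : Mat n) := by rw [wedge_swap]; rfl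
    refine Prod.ext ?_ ?_
    · simp only [Prod.fst_sub]
      rw [hc, ← conj_wedge, Matrix.smul_mul, mul_assoc _ q.1ᵀ, transpose_mul_self hq, mul_one,
        ← mul_sub, add_sub_add_comm, wedge_commutator (proj_dotProduct_self hq) h₂ h₁, hs,
        ← Matrix.mul_smul]
      congr 1
      module
    · simp only [Prod.snd_sub]
      rw [hc, ← radius_smul_mulVec_proj hq, Matrix.mulVec_smul, Matrix.smul_mulVec, wedge_mulVec,
        mulVec_dotProduct_mulVec hq, mulVec_dotProduct_mulVec hq, h₁, h₂, dotProduct_comm u₂ u₁]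
      simp
  rw [hz, sub_self]
  refine (mem_distribution_iff hq _).2 ⟨0, zero_dotProduct _, ?_⟩
  rw [horizontalVec, ← zero_smul ℝ (0 : Vec n), wedge_smul]
  simp
  rfl

theorem curvature_horizontalVec {q : Amb n} (hq : q ∈ B.config) {u₁ u₂ : Vec n}
    (h₁ : u₁ ⬝ᵥ B.proj q = 0) (h₂ : u₂ ⬝ᵥ B.proj q = 0) :
    B.curvature q (B.horizontalVec q u₁) (B.horizontalVec q u₂)
      = (2 * B.eps - 1) • wedge (q.1 *ᵥ u₂) (q.1 *ᵥ u₁) :=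
  isCurvature_unique hq (Classical.epsilon_spec ⟨_, isCurvature_horizontalVec hq h₁ h₂⟩)
    (isCurvature_horizontalVec hq h₁ h₂)

/-- The curvature element annihilates `r`, so the translational momentum does not contribute.
Replacing `𝕀` by `𝐈` is harmless because `γ ∧ u₁` is orthogonal to `u₂ ∧ u₁`. -/
theorem momentum_curvature {q : Amb n} (hq : q ∈ B.config) {u₁ u₂ : Vec n}
    (h₁ : u₁ ⬝ᵥ B.proj q = 0) (h₂ : u₂ ⬝ᵥ B.proj q = 0) :
    B.momentum q (B.horizontalVec q u₁)
        (B.curvature q (B.horizontalVec q u₁) (B.horizontalVec q u₂))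
      = (2 * B.eps - 1) * ip (B.modInertia (wedge (B.proj q) u₁)) (wedge u₂ u₁) := by
  have hc : (((2 * B.eps - 1) • wedge (q.1 *ᵥ u₂) (q.1 *ᵥ u₁) : So n) : Mat n)
      = (2 * B.eps - 1) • (wedge (q.1 *ᵥ u₂) (q.1 *ᵥ u₁) : Mat n) := rfl
  have h₂' : B.proj q ⬝ᵥ u₂ = 0 := by rw [dotProduct_comm, h₂]
  have h₁' : B.proj q ⬝ᵥ u₁ = 0 := by rw [dotProduct_comm, h₁]
  have hr : (wedge (q.1 *ᵥ u₂) (q.1 *ᵥ u₁) : Mat n) *ᵥ q.2 = 0 := by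
    rw [← radius_smul_mulVec_proj hq, Matrix.mulVec_smul, wedge_mulVec,
      mulVec_dotProduct_mulVec hq, mulVec_dotProduct_mulVec hq, h₁, h₂]
    simp
  rw [curvature_horizontalVec hq h₁ h₂, momentum, fderiv_lagrangian_velocity, generator, hc,
    Matrix.smul_mulVec, hr, smul_zero, dotProduct_zero, mul_zero, add_zero, ← conj_wedge,
    horizontalVec]
  simp only
  rw [← mul_assoc, transpose_mul_self hq, one_mul, Matrix.smul_mul, mul_assoc _ q.1ᵀ,
    transpose_mul_self hq, mul_one, Matrix.mul_smul, ← mul_assoc, transpose_mul_self hq, one_mul,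
    B.isBilinearMap_inertiaForm.smul_right, inertiaForm_coe, ip_modInertia, ip_wedge_wedge, h₁',
    h₂', smul_eq_mul]
  ring

end Ball

end RubberRolling

/-! ### `C²` curves and the reduced Euler–Lagrange equation. -/

section SmoothCurves

variable {E : Type*} [NormedAddCommGroup E] [NormedSpace ℝ E] {J : Set ℝ} {γ : ℝ → E}

theorem ContDiffOn.deriv_one_of_two (hJ : IsOpen J) (h : ContDiffOn ℝ 2 γ J) :
    ContDiffOn ℝ 1 (deriv γ) J :=
  ((contDiffOn_succ_iff_deriv_of_isOpen (n := 1) hJ).1 (by simpa [one_add_one_eq_two] using h)).2.2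

theorem ContDiffOn.hasDerivAt_of_isOpen {k : ℕ∞ω} (hJ : IsOpen J) (h : ContDiffOn ℝ k γ J)
    (hk : k ≠ 0) {t : ℝ} (ht : t ∈ J) : HasDerivAt γ (deriv γ t) t :=
  ((h.differentiableOn hk).differentiableAt (hJ.mem_nhds ht)).hasDerivAt

theorem contDiffOn_succ_of_hasDerivAt (hJ : IsOpen J) {k : ℕ} {f : ℝ → E}
    (h : ∀ t ∈ J, HasDerivAt γ (f t) t) (hf : ContDiffOn ℝ k f J) :
    ContDiffOn ℝ (k + 1 : ℕ) γ J := by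
  push_cast
  refine (contDiffOn_succ_iff_deriv_of_isOpen hJ).2
    ⟨fun t ht => (h t ht).differentiableAt.differentiableWithinAt, by simp, ?_⟩
  exact hf.congr fun t ht => (h t ht).deriv

end SmoothCurves

namespace RubberRolling

/-- The momentum is a curve of covectors; in finite dimension it is `C¹` once its values on fixed
vectors are, and then evaluation commutes with `d/dt`. -/
theorem eulerLagrange_apply {V : Type*} [NormedAddCommGroup V] [NormedSpace ℝ V]
    [FiniteDimensional ℝ V] {L : V → V → ℝ} {q : ℝ → V} {J : Set ℝ} (hJ : IsOpen J) {t : ℝ}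
    (ht : t ∈ J) {P : V → ℝ → ℝ}
    (hP : ∀ s ∈ J, ∀ v, fderiv ℝ (fun w => L (q s) w) (deriv q s) v = P v s)
    (hP' : ∀ v, ContDiffOn ℝ 1 (P v) J) (δ : V) :
    eulerLagrange L q t δ = deriv (P δ) t - fderiv ℝ (fun x => L x (deriv q t)) (q t) δ := by
  have hF : ContDiffOn ℝ 1 (fun s => fderiv ℝ (fun w => L (q s) w) (deriv q s)) J :=
    contDiffOn_clm_apply.2 fun v => (hP' v).congr fun s hs => hP s hs v
  have h1 := (hF.hasDerivAt_of_isOpen hJ one_ne_zero ht).clm_apply (hasDerivAt_const t δ)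
  rw [map_zero, add_zero] at h1
  have h2 : (fun s => fderiv ℝ (fun w => L (q s) w) (deriv q s) δ) =ᶠ[nhds t] P δ := by
    filter_upwards [hJ.mem_nhds ht] with s hs using hP s hs δ
  rw [eulerLagrange, sub_apply, ← h2.deriv_eq, h1.deriv]

variable {n : ℕ}

namespace Ball

variable (B : Ball n)

theorem ip_modInertia_comm (X Y : So n) : ip (B.modInertia X) Y = ip (B.modInertia Y) X := by
  rw [ip_modInertia, ip_modInertia, B.inertia_symm, ip_comm X (B.inertia Y), ip_comm X Y]

theorem isBilinearMap_modInertia_wedge :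
    IsBilinearMap ℝ (fun x y : Vec n => (B.modInertia (wedge x y) : Mat n)) where
  add_left := fun x y z => by rw [isBilinearMap_wedge.add_left, map_add]; rfl
  smul_left := fun c x y => by rw [isBilinearMap_wedge.smul_left, map_smul]; rfl
  add_right := fun x y z => by rw [isBilinearMap_wedge.add_right, map_add]; rfl
  smul_right := fun c x y => by rw [isBilinearMap_wedge.smul_right, map_smul]; rfl

theorem modInertia_mulVec_dotProduct (X : So n) (x y : Vec n) :
    ((B.modInertia X : Mat n) *ᵥ x) ⬝ᵥ y = -ip (B.modInertia X) (wedge x y) := by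
  rw [ip_wedge, dotProduct_mulVec_skew, neg_neg]

theorem hasDerivAt_reducedLagrangian {γ v : ℝ → Vec n} {γ' v' : Vec n} {t : ℝ}
    (hγ : HasDerivAt γ γ' t) (hv : HasDerivAt v v' t) :
    HasDerivAt (fun s => B.reducedLagrangian (γ s) (v s))
      (1 / B.eps ^ 2 * (ip (B.modInertia (wedge (γ t) (v t))) (wedge γ' (v t))
        + ip (B.modInertia (wedge (γ t) (v t))) (wedge (γ t) v'))) t := by
  have h := isBilinearMap_dotProduct.hasDerivAt hγ
    (isBilinearMap_mulVec.hasDerivAt (B.isBilinearMap_modInertia_wedge.hasDerivAt hγ hv) hv)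
  have hL : (fun s => B.reducedLagrangian (γ s) (v s)) = fun s => 1 / (2 * B.eps ^ 2) *
      (γ s ⬝ᵥ (B.modInertia (wedge (γ s) (v s)) : Mat n) *ᵥ v s) := by
    funext s; rw [reducedLagrangian, ip_wedge]
  rw [hL]
  refine (h.const_mul _).congr_deriv ?_
  simp only [Matrix.add_mulVec, dotProduct_add, ← ip_wedge]
  rw [ip_modInertia_comm B (wedge γ' _), ip_modInertia_comm B (wedge _ v')]
  have := B.eps_ne_zero
  field_simp
  ring

theorem contDiff_reducedLagrangian {k : ℕ∞ω} :
    ContDiff ℝ k (fun p : Vec n × Vec n => B.reducedLagrangian p.1 p.2) := by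
  have hL : (fun p : Vec n × Vec n => B.reducedLagrangian p.1 p.2)
      = fun p => 1 / (2 * B.eps ^ 2) *
        (p.1 ⬝ᵥ (B.modInertia (wedge p.1 p.2) : Mat n) *ᵥ p.2) := by
    funext p; rw [reducedLagrangian, ip_wedge]
  rw [hL]
  exact contDiff_const.mul (isBilinearMap_dotProduct.contDiff contDiff_fst
    (isBilinearMap_mulVec.contDiff
      (B.isBilinearMap_modInertia_wedge.contDiff contDiff_fst contDiff_snd) contDiff_snd))

theorem fderiv_reducedLagrangian_velocity (γ v δ : Vec n) :
    fderiv ℝ (fun w => B.reducedLagrangian γ w) v δ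
      = 1 / B.eps ^ 2 * ip (B.modInertia (wedge γ v)) (wedge γ δ) := by
  refine fderiv_apply_of_hasDerivAt_line
    ((B.contDiff_reducedLagrangian (k := 1)).comp
      (contDiff_const.prodMk contDiff_id)).contDiffAt.differentiableAt_one ?_
  refine (B.hasDerivAt_reducedLagrangian (hasDerivAt_const (0 : ℝ) γ)
    (hasDerivAt_line v δ)).congr_deriv ?_
  simp only [zero_smul, add_zero]
  rw [ip_wedge _ 0, zero_dotProduct, zero_add]

theorem fderiv_reducedLagrangian_position (γ v δ : Vec n) :
    fderiv ℝ (fun x => B.reducedLagrangian x v) γ δ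
      = 1 / B.eps ^ 2 * ip (B.modInertia (wedge γ v)) (wedge δ v) := by
  refine fderiv_apply_of_hasDerivAt_line
    ((B.contDiff_reducedLagrangian (k := 1)).comp
      (contDiff_id.prodMk contDiff_const)).contDiffAt.differentiableAt_one ?_
  refine (B.hasDerivAt_reducedLagrangian (hasDerivAt_line γ δ)
    (hasDerivAt_const (0 : ℝ) v)).congr_deriv ?_
  simp only [zero_smul, add_zero]
  rw [ip_wedge _ _ 0, Matrix.mulVec_zero, dotProduct_zero, add_zero]

section Curves

variable {B} {J : Set ℝ} {γ : ℝ → Vec n} {t : ℝ}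

theorem hasDerivAt_modInertia_wedge (hJ : IsOpen J) (hγ : ContDiffOn ℝ 2 γ J) (ht : t ∈ J) :
    HasDerivAt (fun s => (B.modInertia (wedge (γ s) (deriv γ s)) : Mat n))
      (B.modInertia (wedge (γ t) (deriv (deriv γ) t)) : Mat n) t := by
  refine (B.isBilinearMap_modInertia_wedge.hasDerivAt
    (hγ.hasDerivAt_of_isOpen hJ two_ne_zero ht)
    ((hγ.deriv_one_of_two hJ).hasDerivAt_of_isOpen hJ one_ne_zero ht)).congr_deriv ?_
  rw [wedge_self, map_zero]
  exact zero_add _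

/-- As `γ̇ ∧ γ̇ = 0`, the product rule produces `𝐈(γ ∧ γ̈) γ` and `𝐈(γ ∧ γ̇) γ̇`; the latter has
total coefficient `ε + (1 - ε) = 1`. -/
theorem reducedEquation_iff (hJ : IsOpen J) (hγ : ContDiffOn ℝ 2 γ J) (ht : t ∈ J) (ξ : Vec n) :
    B.ReducedEquation γ t ξ ↔
      ip (B.modInertia (wedge (γ t) (deriv γ t))) (wedge ξ (deriv γ t))
        - B.eps * ip (B.modInertia (wedge (γ t) (deriv (deriv γ) t))) (wedge (γ t) ξ) = 0 := by
  have hd := isBilinearMap_mulVec.hasDerivAt (B.hasDerivAt_modInertia_wedge hJ hγ ht)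
    (hγ.hasDerivAt_of_isOpen hJ two_ne_zero ht)
  rw [ReducedEquation, hd.deriv]
  simp only [add_dotProduct, smul_dotProduct, modInertia_mulVec_dotProduct, smul_eq_mul]
  rw [wedge_swap ξ (deriv γ t), ← neg_one_smul ℝ (wedge ξ (deriv γ t)),
    isBilinearMap_ip.smul_right, smul_eq_mul]
  constructor <;> intro h <;> linarith

theorem eulerLagrange_reducedLagrangian (hJ : IsOpen J) (hγ : ContDiffOn ℝ 2 γ J) (ht : t ∈ J)
    (ξ : Vec n) :
    eulerLagrange B.reducedLagrangian γ t ξ = 1 / B.eps ^ 2 *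
      (ip (B.modInertia (wedge (γ t) (deriv (deriv γ) t))) (wedge (γ t) ξ)
        - 2 * ip (B.modInertia (wedge (γ t) (deriv γ t))) (wedge ξ (deriv γ t))) := by
  have hγ1 := hγ.deriv_one_of_two hJ
  have hγ0 : ContDiffOn ℝ 1 γ J := hγ.of_le one_le_two
  rw [eulerLagrange_apply hJ ht
    (P := fun v s => 1 / B.eps ^ 2 *
      (γ s ⬝ᵥ (B.modInertia (wedge (γ s) (deriv γ s)) : Mat n) *ᵥ v))
    (fun s _ v => by rw [fderiv_reducedLagrangian_velocity, ip_wedge])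
    (fun v => contDiffOn_const.mul (isBilinearMap_dotProduct.contDiffOn hγ0
      (isBilinearMap_mulVec.contDiffOn
        (B.isBilinearMap_modInertia_wedge.contDiffOn hγ0 hγ1) contDiffOn_const))),
    fderiv_reducedLagrangian_position]
  have hd := (isBilinearMap_dotProduct.hasDerivAt (hγ.hasDerivAt_of_isOpen hJ two_ne_zero ht)
    (isBilinearMap_mulVec.hasDerivAt (B.hasDerivAt_modInertia_wedge hJ hγ ht)
      (hasDerivAt_const t ξ))).const_mul (1 / B.eps ^ 2)
  rw [hd.deriv, Matrix.mulVec_zero, add_zero, ← ip_wedge, ← ip_wedge, wedge_swap ξ (deriv γ t),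
    ← neg_one_smul ℝ (wedge ξ (deriv γ t)), isBilinearMap_ip.smul_right]
  ring

theorem deriv_dotProduct_eq_zero (hJ : IsOpen J) (hγ : IsSphereCurve J γ) (ht : t ∈ J) :
    deriv γ t ⬝ᵥ γ t = 0 := by
  have hd := hγ.1.hasDerivAt_of_isOpen hJ two_ne_zero ht
  have h1 := isBilinearMap_dotProduct.hasDerivAt hd hd
  have h2 : (fun s => γ s ⬝ᵥ γ s) =ᶠ[nhds t] fun _ => 1 := by
    filter_upwards [hJ.mem_nhds ht] with s hs using hγ.2 s hs
  have h3 := (h1.congr_of_eventuallyEq h2.symm).unique (hasDerivAt_const t (1 : ℝ))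
  rw [dotProduct_comm (γ t)] at h3
  linarith

theorem exists_config_proj_eq {x : Vec n} (hx : x ⬝ᵥ x = 1) :
    ∃ q ∈ B.config, B.proj q = x := by
  refine ⟨(1, B.radius • x), ⟨one_mem _, ?_⟩, ?_⟩
  · simp [hx, pow_two]
  · simp [proj, normal, smul_smul, B.radius_ne_zero]

theorem reducedLagrangeDAlembert_iff (hJ : IsOpen J) (hγ : IsSphereCurve J γ) (ht : t ∈ J)
    {ξ : Vec n} (hξ : ξ ⬝ᵥ γ t = 0) :
    B.ReducedLagrangeDAlembert γ t ξ ↔ B.ReducedEquation γ t ξ := by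
  have hε := B.eps_ne_zero
  have hv := deriv_dotProduct_eq_zero hJ hγ ht
  have hR : ∀ q ∈ B.config, B.proj q = γ t →
      B.momentum q (B.horizontalLift q (deriv γ t))
        (B.curvature q (B.horizontalLift q (deriv γ t)) (B.horizontalLift q ξ))
      = (2 * B.eps - 1) / B.eps ^ 3 *
        ip (B.modInertia (wedge (γ t) (deriv γ t))) (wedge ξ (deriv γ t)) := by
    intro q hq hqγ
    rw [← hqγ] at hv hξ
    rw [horizontalLift_eq hq hv, horizontalLift_eq hq hξ, momentum_curvature hq
      (by rw [smul_dotProduct, hv, smul_zero]) (by rw [smul_dotProduct, hξ, smul_zero]), hqγ,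
      isBilinearMap_wedge.smul_right, isBilinearMap_wedge.smul_right,
      isBilinearMap_wedge.smul_left, map_smul, isBilinearMap_ip.smul_left,
      isBilinearMap_ip.smul_right, isBilinearMap_ip.smul_right]
    simp only [smul_eq_mul]
    field_simp
  -- The reduced equation is quantified over the fibre, so the forward implication needs a point in
  -- it. The right side is the same at every such point.
  obtain ⟨q₀, hq₀, hq₀γ⟩ := B.exists_config_proj_eq (hγ.2 t ht)
  have h1 : B.ReducedLagrangeDAlembert γ t ξ ↔
      -(eulerLagrange B.reducedLagrangian γ t ξ) = (2 * B.eps - 1) / B.eps ^ 3 *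
        ip (B.modInertia (wedge (γ t) (deriv γ t))) (wedge ξ (deriv γ t)) :=
    ⟨fun h => (h q₀ hq₀ hq₀γ).trans (hR q₀ hq₀ hq₀γ),
      fun h q hq hqγ => h.trans (hR q hq hqγ).symm⟩
  rw [h1, reducedEquation_iff hJ hγ.1 ht, eulerLagrange_reducedLagrangian hJ hγ.1 ht]
  generalize ip (B.modInertia (wedge (γ t) (deriv γ t))) (wedge ξ (deriv γ t)) = b
  generalize ip (B.modInertia (wedge (γ t) (deriv (deriv γ) t))) (wedge (γ t) ξ) = a
  field_simp
  constructor <;> intro h <;> linarith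

end Curves

/-! ### Admissible curves, the full equations of motion and lifting. -/

section Lift

variable {B} {J : Set ℝ} {q : ℝ → Amb n} {t : ℝ}

theorem IsAdmissibleCurve.isSphereCurve_proj (hq : B.IsAdmissibleCurve J q) :
    IsSphereCurve J (fun s => B.proj (q s)) :=
  ⟨B.contDiff_proj.comp_contDiffOn hq.1, fun t ht => proj_dotProduct_self (hq.2 t ht).1⟩

theorem IsAdmissibleCurve.deriv_eq (hJ : IsOpen J) (hq : B.IsAdmissibleCurve J q) (ht : t ∈ J) :
    deriv q t = B.horizontalVec (q t) (B.eps⁻¹ • deriv (fun s => B.proj (q s)) t) := by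
  have hd := hq.1.hasDerivAt_of_isOpen hJ two_ne_zero ht
  have hp := (B.hasDerivAt_proj hd).deriv
  rw [← fderiv_proj] at hp
  refine (isHorizontalLift_iff (hq.2 t ht).1
    (deriv_dotProduct_eq_zero hJ hq.isSphereCurve_proj ht) _).1 ⟨(hq.2 t ht).2, hp.symm⟩

end Lift

end Ball

end RubberRolling

namespace RubberRolling

namespace Ball

variable {n : ℕ} {B : Ball n} {J : Set ℝ} {q : ℝ → Amb n} {t : ℝ}

theorem eulerLagrange_lagrangian_apply (hJ : IsOpen J) (hq : ContDiffOn ℝ 2 q J) (ht : t ∈ J)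
    (δ : Amb n) :
    eulerLagrange B.lagrangian q t δ
      = deriv (fun s => B.inertiaForm ((q s).1ᵀ * (deriv q s).1) ((q s).1ᵀ * δ.1)
          + B.mass * ((deriv q s).2 ⬝ᵥ δ.2)) t
        - B.inertiaForm ((q t).1ᵀ * (deriv q t).1) (δ.1ᵀ * (deriv q t).1) := by
  have hq1 := hq.deriv_one_of_two hJ
  have hq0 : ContDiffOn ℝ 1 q J := hq.of_le one_le_two
  have hT : ContDiffOn ℝ 1 (fun s => (q s).1ᵀ) J :=
    (transposeCLM (Fin n)).contDiff.comp_contDiffOn hq0.fst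
  have hP : ∀ v : Amb n, ContDiffOn ℝ 1
      (fun s => B.inertiaForm ((q s).1ᵀ * (deriv q s).1) ((q s).1ᵀ * v.1)
        + B.mass * ((deriv q s).2 ⬝ᵥ v.2)) J := fun v =>
    (B.isBilinearMap_inertiaForm.contDiffOn
      (isBilinearMap_matrix_mul.contDiffOn hT hq1.fst)
      (isBilinearMap_matrix_mul.contDiffOn hT contDiffOn_const)).add
      (contDiffOn_const.mul (isBilinearMap_dotProduct.contDiffOn hq1.snd contDiffOn_const))
  have h := eulerLagrange_apply (L := B.lagrangian) hJ ht
    (P := fun v s => B.inertiaForm ((q s).1ᵀ * (deriv q s).1) ((q s).1ᵀ * v.1)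
      + B.mass * ((deriv q s).2 ⬝ᵥ v.2))
    (fun s _ v => B.fderiv_lagrangian_velocity _ _ _) hP δ
  exact h.trans (congrArg _ (B.fderiv_lagrangian_position _ _ _))

/-- Agreement with `γ` is required only on `J`, so two lifts of one curve satisfy literally the same
linear equation. -/
theorem IsAdmissibleCurve.deriv_fst (hJ : IsOpen J) (hq : B.IsAdmissibleCurve J q) (ht : t ∈ J)
    {γ : ℝ → Vec n} (hγ : Set.EqOn (fun s => B.proj (q s)) γ J) :
    (deriv q t).1 = (q t).1 * B.eps⁻¹ • (wedge (γ t) (deriv γ t) : Mat n) := by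
  have hd : deriv (fun s => B.proj (q s)) t = deriv γ t := by
    refine Filter.EventuallyEq.deriv_eq ?_
    filter_upwards [hJ.mem_nhds ht] with s hs using hγ hs
  have hγt : B.proj (q t) = γ t := hγ ht
  refine (congrArg Prod.fst (hq.deriv_eq hJ ht)).trans ?_
  rw [hd, horizontalVec, hγt, wedge_smul]
  rfl

theorem IsAdmissibleCurve.deriv_snd (hJ : IsOpen J) (hq : B.IsAdmissibleCurve J q) (ht : t ∈ J) :
    (deriv q t).2 = (-(B.sgn * B.ρ) * B.eps⁻¹) •
      ((q t).1 *ᵥ deriv (fun s => B.proj (q s)) t) := by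
  refine (congrArg Prod.snd (hq.deriv_eq hJ ht)).trans ?_
  rw [horizontalVec, Matrix.mulVec_smul, smul_smul]

theorem IsAdmissibleCurve.hasDerivAt_fst (hJ : IsOpen J) (hq : B.IsAdmissibleCurve J q)
    (ht : t ∈ J) {γ : ℝ → Vec n} (hγ : Set.EqOn (fun s => B.proj (q s)) γ J) :
    HasDerivAt (fun s => (q s).1)
      ((q t).1 * B.eps⁻¹ • (wedge (γ t) (deriv γ t) : Mat n)) t :=
  (hq.1.hasDerivAt_of_isOpen hJ two_ne_zero ht).prod_fst.congr_deriv (hq.deriv_fst hJ ht hγ)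

theorem IsAdmissibleCurve.hasDerivAt_momentum (hJ : IsOpen J) (hq : B.IsAdmissibleCurve J q)
    (ht : t ∈ J) {γ : ℝ → Vec n} (hγq : γ = fun s => B.proj (q s)) (δ : Amb n) :
    HasDerivAt (fun s => B.inertiaForm ((q s).1ᵀ * (deriv q s).1) ((q s).1ᵀ * δ.1)
        + B.mass * ((deriv q s).2 ⬝ᵥ δ.2))
      (B.inertiaForm (B.eps⁻¹ • (wedge (γ t) (deriv (deriv γ) t) : Mat n)) ((q t).1ᵀ * δ.1)
        + B.inertiaForm (B.eps⁻¹ • (wedge (γ t) (deriv γ t) : Mat n))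
          (((q t).1 * B.eps⁻¹ • (wedge (γ t) (deriv γ t) : Mat n))ᵀ * δ.1)
        + B.mass * (((-(B.sgn * B.ρ) * B.eps⁻¹) •
          (((q t).1 * B.eps⁻¹ • (wedge (γ t) (deriv γ t) : Mat n)) *ᵥ deriv γ t
            + (q t).1 *ᵥ deriv (deriv γ) t)) ⬝ᵥ δ.2)) t := by
  have hγ : IsSphereCurve J γ := hγq ▸ hq.isSphereCurve_proj
  have hγ1 := hγ.1.hasDerivAt_of_isOpen hJ two_ne_zero ht
  have hγ2 := (hγ.1.deriv_one_of_two hJ).hasDerivAt_of_isOpen hJ one_ne_zero ht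
  have hg := hq.hasDerivAt_fst hJ ht (fun s _ => (congrFun hγq s).symm)
  have hev : (fun s => B.inertiaForm ((q s).1ᵀ * (deriv q s).1) ((q s).1ᵀ * δ.1)
      + B.mass * ((deriv q s).2 ⬝ᵥ δ.2)) =ᶠ[nhds t]
      fun s => B.inertiaForm (B.eps⁻¹ • (wedge (γ s) (deriv γ s) : Mat n)) ((q s).1ᵀ * δ.1)
        + B.mass * (((-(B.sgn * B.ρ) * B.eps⁻¹) • ((q s).1 *ᵥ deriv γ s)) ⬝ᵥ δ.2) := by
    filter_upwards [hJ.mem_nhds ht] with s hs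
    rw [hq.deriv_fst hJ hs (fun s _ => (congrFun hγq s).symm), hq.deriv_snd hJ hs, ← mul_assoc,
      transpose_mul_self (hq.2 s hs).1, one_mul, ← hγq]
  have hd1 := B.isBilinearMap_inertiaForm.hasDerivAt
    ((isBilinearMap_coe_wedge.hasDerivAt hγ1 hγ2).const_smul B.eps⁻¹)
    (isBilinearMap_matrix_mul.hasDerivAt hg.matrix_transpose (hasDerivAt_const t δ.1))
  have hd2 := isBilinearMap_dotProduct.hasDerivAt
    ((isBilinearMap_mulVec.hasDerivAt hg hγ2).const_smul (-(B.sgn * B.ρ) * B.eps⁻¹))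
    (hasDerivAt_const t δ.2)
  refine HasDerivAt.congr_of_eventuallyEq ?_ hev
  refine (hd1.add (hd2.const_mul B.mass)).congr_deriv ?_
  have hw : (wedge (deriv γ t) (deriv γ t) : Mat n) = 0 := by rw [wedge_self]; rfl
  simp only [hw, zero_add, Matrix.mul_zero, add_zero, dotProduct_zero]
  rfl

/-- The Euler–Lagrange covector of the constrained system on a horizontal vector. -/
theorem IsAdmissibleCurve.eulerLagrange_lagrangian (hJ : IsOpen J)
    (hq : B.IsAdmissibleCurve J q) (ht : t ∈ J) {γ : ℝ → Vec n} (hγq : γ = fun s => B.proj (q s))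
    {u : Vec n} (hu : u ⬝ᵥ γ t = 0) :
    eulerLagrange B.lagrangian q t (B.horizontalVec (q t) u)
      = -(1 / B.eps ^ 2) *
        (ip (B.modInertia (wedge (γ t) (deriv γ t))) (wedge u (deriv γ t))
          - B.eps * ip (B.modInertia (wedge (γ t) (deriv (deriv γ) t))) (wedge (γ t) u)) := by
  have hε := B.eps_ne_zero
  have hγ : IsSphereCurve J γ := hγq ▸ hq.isSphereCurve_proj
  have hγt : B.proj (q t) = γ t := by rw [hγq]
  have hc := (hq.2 t ht).1
  have hv := deriv_dotProduct_eq_zero hJ hγ ht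
  have hv' : γ t ⬝ᵥ deriv γ t = 0 := by rw [dotProduct_comm, hv]
  have hu' : γ t ⬝ᵥ u = 0 := by rw [dotProduct_comm, hu]
  have hcomm := wedge_commutator (hγ.2 t ht) hu hv
  have hcancel : ∀ A : Mat n, (q t).1ᵀ * ((q t).1 * A) = A := fun A => by
    rw [← mul_assoc, transpose_mul_self hc, one_mul]
  -- One product comes from differentiating `gᵀ` against the fixed test vector, the other from
  -- `∂L/∂q`. Neither need be skew-symmetric, but their difference is the commutator `u ∧ γ̇`.
  have hbr : B.inertiaForm (wedge (γ t) (deriv γ t) : Mat n)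
        ((wedge (γ t) (deriv γ t) : Mat n) * (wedge (γ t) u : Mat n))
      - B.inertiaForm (wedge (γ t) (deriv γ t) : Mat n)
        ((wedge (γ t) u : Mat n) * (wedge (γ t) (deriv γ t) : Mat n))
      = ip (B.inertia (wedge (γ t) (deriv γ t))) (wedge u (deriv γ t)) := by
    have h := B.isBilinearMap_inertiaForm.add_right (wedge (γ t) (deriv γ t) : Mat n)
      (-(wedge u (deriv γ t) : Mat n))
      ((wedge (γ t) (deriv γ t) : Mat n) * (wedge (γ t) u : Mat n))
    rw [← neg_one_smul ℝ (wedge u (deriv γ t) : Mat n), B.isBilinearMap_inertiaForm.smul_right,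
      inertiaForm_coe, neg_one_smul, ← hcomm, sub_add_cancel, smul_eq_mul] at h
    linarith
  rw [eulerLagrange_lagrangian_apply hJ hq.1 ht, (hq.hasDerivAt_momentum hJ ht hγq _).deriv,
    hq.deriv_fst hJ ht (fun s _ => (congrFun hγq s).symm)]
  simp only [horizontalVec, hγt, hcancel, Matrix.transpose_mul, mul_assoc, Matrix.transpose_smul,
    So.transpose, neg_mul, Matrix.smul_mul, Matrix.mul_smul, smul_neg,
    B.isBilinearMap_inertiaForm.smul_left, inertiaForm_coe,
    Matrix.smul_mulVec, ← Matrix.mulVec_mulVec, wedge_mulVec, smul_dotProduct, dotProduct_smul,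
    add_dotProduct, mulVec_dotProduct_mulVec hc, sub_dotProduct, hu', hv', smul_eq_mul,
    Matrix.mulVec_sub, Matrix.mulVec_smul]
  have hneg : ∀ A C : Mat n, B.inertiaForm A (-C) = -B.inertiaForm A C := fun A C => by
    rw [← neg_one_smul ℝ C, B.isBilinearMap_inertiaForm.smul_right]; simp
  have hsmul : ∀ (c : ℝ) (A C : Mat n), B.inertiaForm A (c • C) = c * B.inertiaForm A C :=
    fun c A C => B.isBilinearMap_inertiaForm.smul_right c A C
  simp only [hneg, hsmul, ip_modInertia, ip_wedge_wedge, hγ.2 t ht, hu', hv', D_eq, ← hbr]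
  field_simp
  ring

theorem lagrangeDAlembert_iff (hJ : IsOpen J) (hq : B.IsAdmissibleCurve J q) :
    B.LagrangeDAlembert J q ↔ ∀ t ∈ J, ∀ ξ : Vec n, ξ ⬝ᵥ B.proj (q t) = 0 →
      B.ReducedEquation (fun s => B.proj (q s)) t ξ := by
  have hε : -(1 / B.eps ^ 2) ≠ 0 := neg_ne_zero.2 (by have := B.eps_ne_zero; positivity)
  have key : ∀ t ∈ J, ∀ ξ : Vec n, ξ ⬝ᵥ B.proj (q t) = 0 →
      (eulerLagrange B.lagrangian q t (B.horizontalVec (q t) ξ) = 0 ↔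
        B.ReducedEquation (fun s => B.proj (q s)) t ξ) := fun t ht ξ hξ => by
    rw [hq.eulerLagrange_lagrangian hJ ht rfl hξ,
      reducedEquation_iff hJ hq.isSphereCurve_proj.1 ht, mul_eq_zero, or_iff_right hε]
  constructor
  · intro h t ht ξ hξ
    exact (key t ht ξ hξ).1 (h t ht _ ((mem_distribution_iff (hq.2 t ht).1 _).2 ⟨ξ, hξ, rfl⟩))
  · intro h t ht δ hδ
    obtain ⟨u, hu, rfl⟩ := (mem_distribution_iff (hq.2 t ht).1 _).1 hδ
    exact (key t ht u hu).2 (h t ht u hu)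

/-- Curves on the sphere lift to horizontal curves. -/
theorem exists_isAdmissibleCurve (hJ : IsOpen J) (hJ' : J.OrdConnected) {γ : ℝ → Vec n}
    (hγ : IsSphereCurve J γ) {t₀ : ℝ} (ht₀ : t₀ ∈ J) {q₀ : Amb n} (hq₀ : q₀ ∈ B.config)
    (hq₀γ : B.proj q₀ = γ t₀) :
    ∃ q : ℝ → Amb n, B.IsAdmissibleCurve J q ∧ q t₀ = q₀ ∧ ∀ t ∈ J, B.proj (q t) = γ t := by
  have hε := B.eps_ne_zero
  have hγ1 := hγ.1.deriv_one_of_two hJ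
  have hγ0 : ContDiffOn ℝ 1 γ J := hγ.1.of_le one_le_two
  have hW : ContDiffOn ℝ 1 (fun s => B.eps⁻¹ • (wedge (γ s) (deriv γ s) : Mat n)) J :=
    (isBilinearMap_coe_wedge.contDiffOn hγ0 hγ1).const_smul _
  obtain ⟨g, hg₀, hg⟩ := exists_rotation_curve hJ hJ' hW.continuousOn
    (fun t _ => by rw [Matrix.transpose_smul, So.transpose, smul_neg]) ht₀ hq₀.1
  -- `W` is only `C¹`; each use of `ġ = g W` gains one derivative, from `C⁰` to `C²`.
  have hgW : ContDiffOn ℝ 2 g J := by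
    have h0 : ContDiffOn ℝ 0 g J :=
      contDiffOn_zero.2 fun t ht => (hg t ht).2.continuousAt.continuousWithinAt
    have h1 : ContDiffOn ℝ 1 g J := contDiffOn_succ_of_hasDerivAt hJ (k := 0)
      (fun t ht => (hg t ht).2)
      (isBilinearMap_matrix_mul.contDiffOn h0 (hW.of_le zero_le_one))
    exact contDiffOn_succ_of_hasDerivAt hJ (k := 1) (fun t ht => (hg t ht).2)
      (isBilinearMap_matrix_mul.contDiffOn h1 hW)
  have hgo : ∀ t ∈ J, (g t)ᵀ * g t = 1 := fun t ht => (Matrix.mem_orthogonalGroup_iff' _ _).1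
    (Matrix.mem_specialOrthogonalGroup_iff.1 (hg t ht).1).1
  have hproj : ∀ t ∈ J, B.proj (g t, B.radius • (g t *ᵥ γ t)) = γ t := fun t ht => by
    rw [proj, normal, smul_smul, inv_mul_cancel₀ B.radius_ne_zero, one_smul,
      Matrix.mulVec_mulVec, hgo t ht, Matrix.one_mulVec]
  have hconf : ∀ t ∈ J, (g t, B.radius • (g t *ᵥ γ t)) ∈ B.config := fun t ht => by
    refine ⟨(hg t ht).1, ?_⟩
    simp only
    rw [smul_dotProduct, dotProduct_smul, ← dotProduct_transpose_mulVec, Matrix.mulVec_mulVec,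
      hgo t ht, Matrix.one_mulVec, hγ.2 t ht, smul_eq_mul, smul_eq_mul]
    ring
  refine ⟨fun t => (g t, B.radius • (g t *ᵥ γ t)), ⟨?_, fun t ht => ⟨hconf t ht, ?_⟩⟩, ?_, hproj⟩
  · exact hgW.prodMk ((isBilinearMap_mulVec.contDiffOn hgW hγ.1).const_smul B.radius)
  · have hv := deriv_dotProduct_eq_zero hJ hγ ht
    have hd := (hg t ht).2.prodMk ((isBilinearMap_mulVec.hasDerivAt (hg t ht).2
      (hγ.1.hasDerivAt_of_isOpen hJ two_ne_zero ht)).const_smul B.radius)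
    refine (mem_distribution_iff (hconf t ht) _).2 ⟨B.eps⁻¹ • deriv γ t, ?_, ?_⟩
    · rw [hproj t ht, smul_dotProduct, hv, smul_zero]
    · refine hd.deriv.trans (Prod.ext ?_ ?_)
      · rw [horizontalVec, hproj t ht, wedge_smul]
        rfl
      · rw [horizontalVec, sgn_mul_rho]
        simp only
        rw [← Matrix.mulVec_mulVec, Matrix.smul_mulVec, wedge_mulVec, hv, hγ.2 t ht,
          Matrix.mulVec_smul, Matrix.mulVec_smul, Matrix.mulVec_sub, Matrix.mulVec_smul,
          Matrix.mulVec_smul]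
        -- No slipping reduces to `(σ ± ρ)(1 - ε⁻¹) = -(σ ± ρ)(1 - ε) ε⁻¹`.
        match_scalars <;> field_simp <;> ring
  · simp only [hg₀, ← hq₀γ, radius_smul_mulVec_proj hq₀]

/-- Both rotation parts solve one linear equation with the same initial value, and `r` is recovered
from `g` and `γ`. -/
theorem IsAdmissibleCurve.eqOn (hJ : IsOpen J) (hJ' : J.OrdConnected) {q' : ℝ → Amb n}
    (hq : B.IsAdmissibleCurve J q) (hq' : B.IsAdmissibleCurve J q') {t₀ : ℝ} (ht₀ : t₀ ∈ J)
    (h₀ : q t₀ = q' t₀) (h : ∀ t ∈ J, B.proj (q t) = B.proj (q' t)) : Set.EqOn q q' J := by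
  intro t ht
  have h1 := fun s (hs : s ∈ J) =>
    hq.hasDerivAt_fst hJ hs (γ := fun s => B.proj (q' s)) h
  have h2 := fun s (hs : s ∈ J) =>
    hq'.hasDerivAt_fst hJ hs (γ := fun s => B.proj (q' s)) fun _ _ => rfl
  have hmul : (q t).1 * (q' t).1ᵀ = (q t₀).1 * (q' t₀).1ᵀ := mul_transpose_eq
    (W := fun t => B.eps⁻¹ •
      (wedge (B.proj (q' t)) (deriv (fun s => B.proj (q' s)) t) : Mat n))
    (g := fun s => (q s).1) (h := fun s => (q' s).1) hJ hJ'
    (fun t _ => by rw [Matrix.transpose_smul, So.transpose, smul_neg]) h1 h2 ht₀ ht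
  rw [h₀, mul_transpose_self (hq'.2 t₀ ht₀).1] at hmul
  have hfst : (q t).1 = (q' t).1 := by
    have := congrArg (· * (q' t).1) hmul
    simpa [mul_assoc, transpose_mul_self (hq'.2 t ht).1] using this
  refine Prod.ext hfst ?_
  rw [← radius_smul_mulVec_proj (hq.2 t ht).1, ← radius_smul_mulVec_proj (hq'.2 t ht).1, hfst,
    h t ht]

end Ball

end RubberRolling

theorem theorem4p3 (n : ℕ) (B : RubberRolling.Ball n)
    (J : Set ℝ) (hJ : IsOpen J) (hJ' : J.OrdConnected) :
    -- the constraints are a connection: unique horizontal lifts, and `L_red` is `L` on the lifts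
    (∀ q ∈ B.config, ∀ ξ : RubberRolling.Vec n, ξ ⬝ᵥ B.proj q = 0 →
      (∃! v, B.IsHorizontalLift q ξ v) ∧
      B.lagrangian q (B.horizontalLift q ξ) = B.reducedLagrangian (B.proj q) ξ) ∧
    -- the reduced Lagrange–d'Alembert equation (with the momentum-curvature term) in explicit form
    (∀ γ : ℝ → RubberRolling.Vec n, RubberRolling.Ball.IsSphereCurve J γ →
      ∀ t ∈ J, ∀ ξ : RubberRolling.Vec n, ξ ⬝ᵥ γ t = 0 →
        (B.ReducedLagrangeDAlembert γ t ξ ↔ B.ReducedEquation γ t ξ)) ∧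
    -- an admissible curve is a motion iff its projection satisfies the reduced equation
    (∀ q : ℝ → RubberRolling.Amb n, B.IsAdmissibleCurve J q →
      (B.LagrangeDAlembert J q ↔
        ∀ t ∈ J, ∀ ξ : RubberRolling.Vec n, ξ ⬝ᵥ B.proj (q t) = 0 →
          B.ReducedEquation (fun s => B.proj (q s)) t ξ)) ∧
    -- every solution of the reduced equation lifts, uniquely for given initial position, to a motion
    (∀ γ : ℝ → RubberRolling.Vec n, RubberRolling.Ball.IsSphereCurve J γ →
      (∀ t ∈ J, ∀ ξ : RubberRolling.Vec n, ξ ⬝ᵥ γ t = 0 → B.ReducedEquation γ t ξ) →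
      ∀ t₀ ∈ J, ∀ q₀ ∈ B.config, B.proj q₀ = γ t₀ →
        ∃ q : ℝ → RubberRolling.Amb n,
          (B.IsMotion J q ∧ q t₀ = q₀ ∧ ∀ t ∈ J, B.proj (q t) = γ t) ∧
          ∀ q' : ℝ → RubberRolling.Amb n,
            B.IsMotion J q' → q' t₀ = q₀ → (∀ t ∈ J, B.proj (q' t) = γ t) → Set.EqOn q' q J) := by
  refine ⟨fun q hq ξ hξ => ⟨RubberRolling.Ball.existsUnique_isHorizontalLift hq hξ,
      RubberRolling.Ball.lagrangian_horizontalLift hq hξ⟩,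
    fun γ hγ t ht ξ hξ => RubberRolling.Ball.reducedLagrangeDAlembert_iff hJ hγ ht hξ,
    fun q hq => RubberRolling.Ball.lagrangeDAlembert_iff hJ hq,
    fun γ hγ hred t₀ ht₀ q₀ hq₀ hq₀γ => ?_⟩
  obtain ⟨q, hq, hqt₀, hqγ⟩ :=
    RubberRolling.Ball.exists_isAdmissibleCurve hJ hJ' hγ ht₀ hq₀ hq₀γ
  refine ⟨q, ⟨⟨hq, (RubberRolling.Ball.lagrangeDAlembert_iff hJ hq).2 fun t ht ξ hξ => ?_⟩,
    hqt₀, hqγ⟩, fun q' hq' hq't₀ hq'γ => ?_⟩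
  -- `π ∘ q` and `γ` agree only on `J`; since `J` is open, their first and second derivatives agree
  -- there.
  · rw [RubberRolling.Ball.reducedEquation_iff hJ hq.isSphereCurve_proj.1 ht]
    have hev : (fun s => B.proj (q s)) =ᶠ[nhds t] γ := by
      filter_upwards [hJ.mem_nhds ht] with s hs using hqγ s hs
    rw [hev.deriv.deriv_eq, hev.deriv_eq, hqγ t ht]
    exact (RubberRolling.Ball.reducedEquation_iff hJ hγ.1 ht ξ).1
      (hred t ht ξ (by rw [← hqγ t ht]; exact hξ))
  · exact hq'.1.eqOn hJ hJ' hq ht₀ (hq't₀.trans hqt₀.symm)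
      fun t ht => (hq'γ t ht).trans (hqγ t ht).symm
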